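/- Let $D=d^2$, let $\mathrm H=\mathrm H(\mathbb C^d\otimes\mathbb C^d)$ be the real vector space of Hermitian operators on $\mathbb C^d\otimes\mathbb C^d$ (system $\otimes$ ancilla) with inner product $\langle A,B\rangle=\operatorname{tr}(A^\dagger B)$ and norm $\|A\|=\langle A,A\rangle^{1/2}$, and let $\mathrm Q=\{\rho\in\mathrm H:\rho\ge 0,\ \operatorname{tr}\rho=1\}$ be the set of states. Put $\mathscr Q^{\mathrm{gc}}=\{\rho\in\mathrm Q:\operatorname{tr}_{\mathrm s}\rho=I/d\}$ and $\mathscr Q^{\mathrm{uc}}=\{\rho\in\mathrm Q:\operatorname{tr}_{\mathrm s}\rho=\operatorname{tr}_{\mathrm a}\rho=I/d\}$, where $\operatorname{tr}_{\mathrm s},\operatorname{tr}_{\mathrm a}$ are the partial traces over the first and the second factor. Let $\mathscr Q$ be one of $\mathrm Q,\mathscr Q^{\mathrm{gc}},\mathscr Q^{\mathrm{uc}}$, and let $\operatorname{span}\mathscr Q$ be its real linear span. Let $F$ be a POVM on a measurable space $\mathscr X$ with values in $\mathrm H$, that is, a countably additive positive-operator-valued set function with $F(\mathscr X)=I$. Let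 $\tau(E)=\operatorname{tr}F(E)$ be its trace measure and $P=dF/d\tau$ its density. $F$ is *rank-one* if $P(x)$ has rank one for $\tau$-almost every $x$. Let $\mathcal F=\int d\tau(x)\,|P(x)\rangle\!\rangle\langle\!\langle P(x)|$, i.e. $\mathcal F(A)=\int d\tau(x)\,\langle P(x),A\rangle P(x)$ on $\mathrm H$, let $\operatorname{supp}\mathcal F$ be its image, let $\tilde{\mathcal F}$ be the operator with the same image for which $\tilde{\mathcal F}\mathcal F=\mathcal F\tilde{\mathcal F}$ is the orthogonal projector onto $\operatorname{supp}\mathcal F$, and let $R(x)=\tilde{\mathcal F}(P(x))$ (the canonical dual). $F$ is *tight* if, with $P_0=P-I/D$, the operator $\mathcal F_0=\int d\tau(x)\,|P_0(x)\rangle\!\rangle\langle\!\langle P_0(x)|$ is $a$ times the orthogonal projector onto its own image for some $a>0$. $F$ is *informationally complete with respect to* $\mathscr Q$ if for any distinct $\rho,\sigma\in\mathscr Q$ there is an event $E$ with $\operatorname{tr}[F(E)\rho]\ne\operatorname{tr}[F(E)\sigma]$. A *reconstruction density* is a map $Q:\mathscr X\to\operatorname{span}\mathscr Q$ such that, for every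 $\rho\in\mathscr Q$ and $p_\rho(E)=\operatorname{tr}[F(E)\rho]$, $Q$ is $p_\rho$-integrable and $\rho=\int dp_\rho(x)\,Q(x)$. For $N\ge 1$ and a state $\rho$ let $$e^{(F,Q)}(\rho)=\mathbb E\,\Big\|\rho-\tfrac1N\sum_{k=1}^N Q(y_k)\Big\|^2\in[0,\infty],$$ where $y_1,\dots,y_N$ are independent with law $p_\rho$. For $\sigma\in\mathscr Q$ write $\rho(\sigma,U)=U\sigma U^\dagger$ and, with $\mu$ the unit Haar measure on $\mathrm U(d)$, $$e_{\mathrm{av}}^{(F,Q)}(\sigma)=\iint d\mu(U_{\mathrm s})\,d\mu(U_{\mathrm a})\;e^{(F,Q)}\big(\rho(\sigma,U_{\mathrm s}\otimes U_{\mathrm a})\big),\qquad e_{\mathrm{wc}}^{(F,Q)}(\sigma)=\sup_{U_{\mathrm s},U_{\mathrm a}\in\mathrm U(d)}e^{(F,Q)}\big(\rho(\sigma,U_{\mathrm s}\otimes U_{\mathrm a})\big).$$ **Claim.** Let $F$ be informationally complete with respect to $\mathscr Q$. Then for every $\sigma\in\mathscr Q$ and every reconstruction density $Q$, $$e_{\mathrm{wc}}^{(F,Q)}(\sigma)\;\ge\;e_{\mathrm{av}}^{(F,Q)}(\sigma)\;\ge\;\begin{cases}\frac1N\big(d^4+d^2-1-\operatorname{tr}\sigma^2\big)&\text{if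 }\mathscr Q=\mathrm Q,\\[2pt]\frac1N\big(d^4-d^2+1/d^2-\operatorname{tr}\sigma^2\big)&\text{if }\mathscr Q=\mathscr Q^{\mathrm{gc}},\\[2pt]\frac1N\big(d^4-3d^2+3-\operatorname{tr}\sigma^2\big)&\text{if }\mathscr Q=\mathscr Q^{\mathrm{uc}}.\end{cases}$$ Equality holds in the right-hand inequality if and only if $Q=R$ $\tau$-almost everywhere and $F$ is a tight rank-one POVM with $\operatorname{supp}\mathcal F=\operatorname{span}\mathscr Q$; in that case equality also holds in the left-hand inequality. -/

import Mathlib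

open MeasureTheory Matrix
open scoped ENNReal Kronecker InnerProductSpace ComplexOrder

noncomputable section

/-! ### Hermitian operators with the Hilbert-Schmidt inner product -/

/-- The real vector space of Hermitian operators on `ℂⁿ`. This is a type synonym, so that it carries
only the Hilbert-Schmidt structure below. -/
def Herm (n : Type*) : Type _ := selfAdjoint (Matrix n n ℂ)

namespace Herm

variable {n : Type*}

instance : AddCommGroup (Herm n) := inferInstanceAs (AddCommGroup (selfAdjoint (Matrix n n ℂ)))

instance : Module ℝ (Herm n) := inferInstanceAs (Module ℝ (selfAdjoint (Matrix n n ℂ)))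

/-- The matrix of a Hermitian operator. -/
def mat (A : Herm n) : Matrix n n ℂ := A.1

/-- A Hermitian matrix as a Hermitian operator. -/
def ofMat (A : Matrix n n ℂ) (hA : A.IsHermitian) : Herm n := ⟨A, hA⟩

@[ext] lemma ext {A B : Herm n} (h : A.mat = B.mat) : A = B := Subtype.ext h

@[simp] lemma mat_ofMat (A : Matrix n n ℂ) (hA : A.IsHermitian) : (ofMat A hA).mat = A := rfl

@[simp] lemma mat_zero : (0 : Herm n).mat = 0 := rfl

@[simp] lemma mat_add (A B : Herm n) : (A + B).mat = A.mat + B.mat := rfl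

@[simp] lemma mat_smul (r : ℝ) (A : Herm n) : (r • A).mat = r • A.mat := rfl

lemma isHermitian (A : Herm n) : A.mat.IsHermitian := A.2

variable [Fintype n]

lemma re_trace_self (A : Herm n) : (A.matᴴ * A.mat).trace.re = ∑ i, ∑ j, ‖A.mat j i‖ ^ 2 := by
  simp only [Matrix.trace, Matrix.diag, Matrix.mul_apply, Matrix.conjTranspose_apply,
    Complex.re_sum]
  refine Finset.sum_congr rfl fun i _ => Finset.sum_congr rfl fun j _ => ?_
  rw [Complex.star_def, ← Complex.normSq_eq_conj_mul_self, Complex.ofReal_re,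
    Complex.normSq_eq_norm_sq]

/-- The Hilbert-Schmidt inner product `⟪A, B⟫ = tr (A† B)`; it is real on Hermitian operators. -/
@[reducible] def core : InnerProductSpace.Core ℝ (Herm n) where
  inner A B := (A.matᴴ * B.mat).trace.re
  conj_inner_symm A B := by
    rw [starRingEnd_apply, star_trivial, ← Complex.conj_re, ← Complex.star_def,
      ← Matrix.trace_conjTranspose, Matrix.conjTranspose_mul, Matrix.conjTranspose_conjTranspose]
  re_inner_nonneg A := by
    change 0 ≤ (A.matᴴ * A.mat).trace.re
    rw [re_trace_self]
    positivity
  add_left A B C := by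
    simp [Matrix.add_mul]
  smul_left A B r := by
    simp
  definite A h := by
    rw [re_trace_self] at h
    ext i j
    rw [Finset.sum_eq_zero_iff_of_nonneg (fun _ _ => by positivity)] at h
    have h1 := h j (Finset.mem_univ _)
    rw [Finset.sum_eq_zero_iff_of_nonneg (fun _ _ => by positivity)] at h1
    simpa using h1 i (Finset.mem_univ _)

instance : NormedAddCommGroup (Herm n) := core.toNormedAddCommGroup

instance : InnerProductSpace ℝ (Herm n) := InnerProductSpace.ofCore core.toCore

lemma inner_def (A B : Herm n) : ⟪A, B⟫_ℝ = (A.matᴴ * B.mat).trace.re := rfl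

instance : FiniteDimensional ℝ (Herm n) :=
  inferInstanceAs (FiniteDimensional ℝ (selfAdjoint.submodule ℝ (Matrix n n ℂ)))

/-- The identity operator. -/
def one [DecidableEq n] : Herm n := ofMat 1 Matrix.isHermitian_one

lemma posSemidef_one {n : Type*} [DecidableEq n] : (one : Herm n).mat.PosSemidef := Matrix.PosSemidef.one

end Herm

/-! ### Quantum states -/

open scoped MatrixOrder Matrix.Norms.L2Operator in
lemma Matrix.PosSemidef.re_trace_mul_nonneg {n : Type*} [Fintype n] {A B : Matrix n n ℂ}
    (hA : A.PosSemidef) (hB : B.PosSemidef) : 0 ≤ (A * B).trace.re := by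
  classical
  obtain ⟨C, rfl⟩ := CStarAlgebra.nonneg_iff_eq_star_mul_self.mp hA.nonneg
  rw [Matrix.mul_assoc, Matrix.trace_mul_comm]
  exact (Complex.le_def.mp (hB.mul_mul_conjTranspose_same C).trace_nonneg).1

/-- A quantum state: a positive semidefinite operator of unit trace. -/
structure QState (n : Type*) [Fintype n] where
  /-- The underlying Hermitian operator. -/
  op : Herm n
  posSemidef : op.mat.PosSemidef
  trace_eq_one : op.mat.trace = 1

namespace QState

variable {n : Type*} [Fintype n]

/-- The rotated state `U σ U†`. -/
def rotate [DecidableEq n] (σ : QState n) (U : Matrix.unitaryGroup n ℂ) : QState n where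
  op := Herm.ofMat (U.1 * σ.op.mat * U.1ᴴ) (σ.posSemidef.mul_mul_conjTranspose_same U.1).isHermitian
  posSemidef := σ.posSemidef.mul_mul_conjTranspose_same U.1
  trace_eq_one := by
    rw [Herm.mat_ofMat, Matrix.trace_mul_cycle, ← Matrix.star_eq_conjTranspose,
      Matrix.UnitaryGroup.star_mul_self, Matrix.one_mul, σ.trace_eq_one]

/-- The purity `tr (σ²)`. -/
def purity (σ : QState n) : ℝ := (σ.op.mat * σ.op.mat).trace.re

/-- The real subspace of Hermitian operators spanned by a set of states. -/
def span (S : Set (QState n)) : Submodule ℝ (Herm n) := Submodule.span ℝ (QState.op '' S)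

end QState

/-- The partial trace over the first factor (the system). -/
def traceFst {m n : Type*} [Fintype m] (A : Matrix (m × n) (m × n) ℂ) : Matrix n n ℂ :=
  Matrix.of fun k l => ∑ j, A (j, k) (j, l)

/-- The partial trace over the second factor (the ancilla). -/
def traceSnd {m n : Type*} [Fintype n] (A : Matrix (m × n) (m × n) ℂ) : Matrix m m ℂ :=
  Matrix.of fun j k => ∑ l, A (j, l) (k, l)

/-- Output states of general quantum channels: `tr_s ρ = I / d`. -/
def gcStates (d : ℕ) : Set (QState (Fin d × Fin d)) :=
  {ρ | traceFst ρ.op.mat = (1 / d : ℂ) • 1}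

/-- Output states of unital quantum channels: `tr_s ρ = tr_a ρ = I / d`. -/
def ucStates (d : ℕ) : Set (QState (Fin d × Fin d)) :=
  {ρ | traceFst ρ.op.mat = (1 / d : ℂ) • 1 ∧ traceSnd ρ.op.mat = (1 / d : ℂ) • 1}

/-! ### The inverse of a self-adjoint operator on its support -/

section PseudoInverse

variable {E : Type*} [NormedAddCommGroup E] [InnerProductSpace ℝ E] [FiniteDimensional ℝ E]

/-- The support (image) of a self-adjoint operator. -/
def opSupport (T : E →L[ℝ] E) : Submodule ℝ E := LinearMap.range (T : E →ₗ[ℝ] E)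

/-- The orthogonal projector onto the support. -/
def supportProj (T : E →L[ℝ] E) : E →L[ℝ] E := (opSupport T).starProjection

/-- `S` has the same support as `T` and `S T = T S` is the projector onto this support. -/
def IsSupportInverse (T S : E →L[ℝ] E) : Prop :=
  opSupport S = opSupport T ∧ S ∘L T = supportProj T ∧ T ∘L S = supportProj T

lemma existsUnique_supportInverse {T : E →L[ℝ] E} (hT : ∀ x y, ⟪T x, y⟫_ℝ = ⟪x, T y⟫_ℝ) :
    ∃! S, IsSupportInverse T S := by
  have hmem (x : E) : T x ∈ opSupport T := ⟨x, rfl⟩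
  have hmemP (x : E) : supportProj T x ∈ opSupport T := Submodule.starProjection_apply_mem _ x
  have hself (x : E) (hx : x ∈ opSupport T) : supportProj T x = x :=
    Submodule.starProjection_eq_self_iff.mpr hx
  have hker (x : E) (hx : x ∈ (opSupport T)ᗮ) : T x = 0 := by
    rw [← inner_self_eq_zero (𝕜 := ℝ), hT, real_inner_comm]
    exact (Submodule.mem_orthogonal _ _).mp hx _ (hmem _)
  have hTP (x : E) : T (supportProj T x) = T x := by
    have h := hker _ (Submodule.sub_starProjection_mem_orthogonal (K := opSupport T) x)
    rw [map_sub, sub_eq_zero] at h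
    exact h.symm
  let T' : opSupport T →ₗ[ℝ] opSupport T :=
    (T : E →ₗ[ℝ] E).restrict fun x _ => hmem x
  have hinj : Function.Injective T' := by
    rw [← LinearMap.ker_eq_bot, LinearMap.ker_eq_bot']
    intro x hx
    have hx0 : T x = 0 := congrArg Subtype.val hx
    obtain ⟨y, hy⟩ := x.2
    have hy' : T y = x := hy
    have : ⟪(x : E), (x : E)⟫_ℝ = 0 := by
      nth_rewrite 1 [← hy']
      rw [hT, hx0, inner_zero_right]
    exact Subtype.ext (inner_self_eq_zero.mp this)
  let e : opSupport T ≃ₗ[ℝ] opSupport T := LinearEquiv.ofInjectiveEndo T' hinj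
  have he (x : opSupport T) : (e x : E) = T x := rfl
  let S : E →L[ℝ] E := LinearMap.toContinuousLinearMap
    ((opSupport T).subtype ∘ₗ e.symm.toLinearMap ∘ₗ
      (supportProj T : E →ₗ[ℝ] E).codRestrict (opSupport T) hmemP)
  have hS (x : E) : S x = e.symm ⟨supportProj T x, hmemP x⟩ := rfl
  refine ⟨S, ⟨?_, ?_, ?_⟩, ?_⟩
  · apply le_antisymm
    · rintro _ ⟨x, rfl⟩
      exact (e.symm ⟨supportProj T x, hmemP x⟩).2
    · intro x hx
      refine ⟨e ⟨x, hx⟩, ?_⟩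
      change S (e ⟨x, hx⟩ : E) = x
      rw [hS]
      have : (⟨supportProj T (e ⟨x, hx⟩ : E), hmemP _⟩ : opSupport T) = e ⟨x, hx⟩ :=
        Subtype.ext (hself _ (e ⟨x, hx⟩).2)
      rw [this, LinearEquiv.symm_apply_apply]
  · ext x
    change S (T x) = supportProj T x
    rw [hS]
    have : (⟨supportProj T (T x), hmemP _⟩ : opSupport T) = e ⟨supportProj T x, hmemP x⟩ := by
      apply Subtype.ext
      rw [he, hTP]
      exact hself _ (hmem x)
    rw [this, LinearEquiv.symm_apply_apply]
  · ext x
    change T (S x) = supportProj T x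
    rw [hS, ← he, LinearEquiv.apply_symm_apply]
  · rintro S' ⟨h1, h2, h3⟩
    have h4 (x : E) : S' x ∈ opSupport T := h1 ▸ (⟨x, rfl⟩ : S' x ∈ opSupport S')
    have hTS (x : E) : T (S x) = supportProj T x := by
      rw [hS, ← he, LinearEquiv.apply_symm_apply]
    have hdec (x : E) : S' (supportProj T x) = S x := by
      rw [← hTS x]
      have := congrArg (fun L : E →L[ℝ] E => L (S x)) h2
      refine this.trans (hself _ ?_)
      exact (e.symm ⟨supportProj T x, hmemP x⟩).2
    ext x
    rw [← hdec, ← h3]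
    exact ((congrArg (fun L : E →L[ℝ] E => L (S' x)) h2).trans (hself _ (h4 x))).symm

end PseudoInverse

/-! ### POVMs -/

/-- A positive-operator-valued measure on `X` with values in the Hermitian operators on `ℂⁿ`. -/
structure POVM (X : Type*) [MeasurableSpace X] (n : Type*) [Fintype n] [DecidableEq n] where
  /-- The countably additive operator-valued set function. -/
  toFun : VectorMeasure X (Herm n)
  posSemidef : ∀ E, MeasurableSet E → (toFun E).mat.PosSemidef
  univ : toFun Set.univ = Herm.one

namespace POVM

variable {X : Type*} [MeasurableSpace X] {n : Type*} [Fintype n] [DecidableEq n]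

/-- The signed measure `E ↦ tr (F(E) A)`. -/
def pairing (F : POVM X n) (A : Herm n) : SignedMeasure X :=
  F.toFun.mapRange (innerSL ℝ A : Herm n →L[ℝ] ℝ).toLinearMap.toAddMonoidHom
    (innerSL ℝ A : Herm n →L[ℝ] ℝ).continuous

lemma pairing_apply (F : POVM X n) (A : Herm n) (E : Set X) :
    F.pairing A E = ((F.toFun E).mat * A.mat).trace.re := by
  have h : F.pairing A E = ⟪A, F.toFun E⟫_ℝ := rfl
  rw [h, Herm.inner_def, A.isHermitian.eq, Matrix.trace_mul_comm]

lemma zero_le_pairing (F : POVM X n) (A : Herm n) (hA : A.mat.PosSemidef) :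
    0 ≤[Set.univ] F.pairing A := by
  rw [VectorMeasure.restrict_univ, VectorMeasure.restrict_univ]
  intro E hE
  rw [pairing_apply]
  exact (F.posSemidef E hE).re_trace_mul_nonneg hA

/-- The measure `E ↦ tr (F(E) A)` for a positive semidefinite operator `A`. -/
def pairingMeasure (F : POVM X n) (A : Herm n) (hA : A.mat.PosSemidef) : Measure X :=
  (F.pairing A).toMeasureOfZeroLE Set.univ MeasurableSet.univ (F.zero_le_pairing A hA)

lemma pairingMeasure_apply (F : POVM X n) (A : Herm n) (hA : A.mat.PosSemidef) {E : Set X}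
    (hE : MeasurableSet E) :
    F.pairingMeasure A hA E = ENNReal.ofReal ((F.toFun E).mat * A.mat).trace.re := by
  rw [← pairing_apply, pairingMeasure,
    SignedMeasure.toMeasureOfZeroLE_apply _ _ MeasurableSet.univ hE, ENNReal.ofReal]
  congr 1
  ext
  simp only [NNReal.coe_mk, Set.univ_inter]
  rw [Real.coe_toNNReal]
  rw [pairing_apply]
  exact (F.posSemidef E hE).re_trace_mul_nonneg hA

instance (F : POVM X n) (A : Herm n) (hA : A.mat.PosSemidef) :
    IsFiniteMeasure (F.pairingMeasure A hA) :=
  SignedMeasure.toMeasureOfZeroLE_finite _ _ _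

/-- The distribution `p(E) = tr (F(E) ρ)` of the measurement outcome in the state `ρ`. -/
def outcomeMeasure (F : POVM X n) (ρ : QState n) : Measure X :=
  F.pairingMeasure ρ.op ρ.posSemidef

/-- The trace measure `τ(E) = tr (F(E))`. -/
def traceMeasure (F : POVM X n) : Measure X :=
  F.pairingMeasure Herm.one Herm.posSemidef_one

instance (F : POVM X n) : IsFiniteMeasure F.traceMeasure :=
  inferInstanceAs (IsFiniteMeasure (F.pairingMeasure _ _))

/-- The positive-operator-valued density `P`: the Radon-Nikodym derivative of `F` with respect to
the trace measure, taken coordinatewise in an orthonormal basis of the Hermitian operators. -/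
def density (F : POVM X n) (x : X) : Herm n :=
  ∑ k, (F.pairing (stdOrthonormalBasis ℝ (Herm n) k)).rnDeriv F.traceMeasure x •
    stdOrthonormalBasis ℝ (Herm n) k

lemma integrable_density (F : POVM X n) : Integrable F.density F.traceMeasure :=
  integrable_finsetSum _ fun _ _ => (SignedMeasure.integrable_rnDeriv _ _).smul_const _

lemma setIntegral_density (F : POVM X n) {E : Set X} (hE : MeasurableSet E) :
    ∫ x in E, F.density x ∂F.traceMeasure = F.toFun E := by
  have hac (A : Herm n) : F.pairing A ≪ᵥ F.traceMeasure.toENNRealVectorMeasure := by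
    intro s hs
    by_cases hm : MeasurableSet s
    · rw [Measure.toENNRealVectorMeasure_apply_measurable hm, traceMeasure,
        pairingMeasure_apply _ _ _ hm, ENNReal.ofReal_eq_zero] at hs
      have hpos := F.posSemidef s hm
      have h1 : (F.toFun s).mat.trace.re ≤ 0 := by simpa [Herm.one] using hs
      have h2 := Complex.le_def.mp hpos.trace_nonneg
      have h3 : (F.toFun s).mat = 0 := hpos.trace_eq_zero_iff.mp
        (Complex.ext (le_antisymm h1 h2.1) h2.2.symm)
      rw [pairing_apply, h3]
      simp
    · exact VectorMeasure.not_measurable _ hm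
  simp only [density]
  rw [integral_finsetSum _ fun k _ =>
    ((SignedMeasure.integrable_rnDeriv _ _).smul_const _).integrableOn]
  conv_rhs => rw [← (stdOrthonormalBasis ℝ (Herm n)).sum_repr' (F.toFun E)]
  refine Finset.sum_congr rfl fun k _ => ?_
  rw [integral_smul_const, ← withDensityᵥ_apply (SignedMeasure.integrable_rnDeriv _ _) hE,
    SignedMeasure.withDensityᵥ_rnDeriv_eq _ _ (hac _)]
  rfl

/-- A rank-one POVM: the density has rank one, almost everywhere for the trace measure. -/
def IsRankOne (F : POVM X n) : Prop := ∀ᵐ x ∂F.traceMeasure, (F.density x).mat.rank = 1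

/-- The frame superoperator `𝓕 = ∫ dτ(x) |P(x))(P(x)|` of a POVM. -/
def frameOp (F : POVM X n) : Herm n →L[ℝ] Herm n :=
  ∫ x, InnerProductSpace.rankOne ℝ (F.density x) (F.density x) ∂F.traceMeasure

lemma frameOp_symm (F : POVM X n) (A B : Herm n) : ⟪F.frameOp A, B⟫_ℝ = ⟪A, F.frameOp B⟫_ℝ := by
  by_cases h : Integrable
    (fun x => InnerProductSpace.rankOne ℝ (F.density x) (F.density x)) F.traceMeasure
  · rw [frameOp, ContinuousLinearMap.integral_apply h, ContinuousLinearMap.integral_apply h,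
      real_inner_comm, ← integral_inner (h.apply_continuousLinearMap A),
      ← integral_inner (h.apply_continuousLinearMap B)]
    refine integral_congr_ae (Filter.Eventually.of_forall fun x => ?_)
    simp [InnerProductSpace.rankOne_apply, inner_smul_right, real_inner_comm, mul_comm]
  · rw [frameOp, integral_undef h]
    simp

/-- The superoperator `𝓕~` inverse to `𝓕` on the support of `𝓕`. -/
def frameInverse (F : POVM X n) : Herm n →L[ℝ] Herm n :=
  (existsUnique_supportInverse F.frameOp_symm).choose

/-- The canonical reconstruction density `R = 𝓕~ P`. -/
def canonicalDual (F : POVM X n) (x : X) : Herm n := F.frameInverse (F.density x)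

/-- The traceless part `A - tr(A) I / D` of an operator, where `D` is the dimension of `ℂⁿ`. -/
def tracelessPart (A : Herm n) : Herm n := A - (A.mat.trace.re / Fintype.card n) • Herm.one

/-- The superoperator `𝓕₀ = ∫ dτ(x) |P₀(x))(P₀(x)|` with `P₀` the traceless part of `P`. -/
def frameOpZero (F : POVM X n) : Herm n →L[ℝ] Herm n :=
  ∫ x, InnerProductSpace.rankOne ℝ (tracelessPart (F.density x)) (tracelessPart (F.density x))
    ∂F.traceMeasure

/-- A tight POVM: `𝓕₀` is a positive multiple of the projector onto its support. -/
def IsTight (F : POVM X n) : Prop := ∃ a : ℝ, 0 < a ∧ F.frameOpZero = a • supportProj F.frameOpZero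

/-- Informational completeness with respect to a set of states. -/
def IsInfoComplete (F : POVM X n) (S : Set (QState n)) : Prop :=
  ∀ ρ ∈ S, ∀ σ ∈ S, ρ ≠ σ → ∃ E, MeasurableSet E ∧
    ((F.toFun E).mat * ρ.op.mat).trace ≠ ((F.toFun E).mat * σ.op.mat).trace

/-- `Q : X → span S` is a reconstruction operator-valued density for the states in `S`: the formula
`ρ = ∫ dp(x) Q(x)` holds (with a convergent integral) for every `ρ ∈ S`. -/
structure IsReconstruction (F : POVM X n) (S : Set (QState n)) (Q : X → Herm n) : Prop where
  mem_span : ∀ x, Q x ∈ QState.span S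
  integrable : ∀ ρ ∈ S, Integrable Q (F.outcomeMeasure ρ)
  reconstruct : ∀ ρ ∈ S, ρ.op = ∫ x, Q x ∂F.outcomeMeasure ρ

end POVM

/-! ### Errors of the linear tomographic estimate -/

section Errors

variable {X : Type*} [MeasurableSpace X]

/-- The linear tomographic estimate `ρ^ = (1/N) ∑ₖ Q(yₖ)`, i.e. the integral of `Q` against the
empirical distribution of the outcomes `y₁, …, y_N`. -/
def linearEstimate {n : Type*} {N : ℕ} (Q : X → Herm n) (y : Fin N → X) : Herm n :=
  (1 / N : ℝ) • ∑ k, Q (y k)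

/-- The expected squared Hilbert-Schmidt distance `e(ρ) = 𝔼 ‖ρ - ρ^(y₁, …, y_N)‖²` between a state
and its estimate, for independent outcomes of `N` measurements; the value `∞` is allowed. -/
def expectedError {n : Type*} [Fintype n] [DecidableEq n] (F : POVM X n) (Q : X → Herm n) (N : ℕ)
    (ρ : QState n) : ℝ≥0∞ :=
  ∫⁻ y, ENNReal.ofReal (‖ρ.op - linearEstimate Q y‖ ^ 2)
    ∂(Measure.pi fun _ : Fin N => F.outcomeMeasure ρ)

instance (d : ℕ) : MeasurableSpace (Matrix.unitaryGroup (Fin d) ℂ) := borel _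

instance (d : ℕ) : BorelSpace (Matrix.unitaryGroup (Fin d) ℂ) := ⟨rfl⟩

instance (d : ℕ) : CompactSpace (Matrix.unitaryGroup (Fin d) ℂ) := by
  have hK : IsCompact (Set.pi Set.univ fun _ : Fin d => Set.pi Set.univ fun _ : Fin d =>
      Metric.closedBall (0 : ℂ) 1) :=
    isCompact_univ_pi fun _ => isCompact_univ_pi fun _ => isCompact_closedBall _ _
  refine isCompact_iff_compactSpace.mp (hK.of_isClosed_subset
    (isClosed_unitary (R := Matrix (Fin d) (Fin d) ℂ)) ?_)
  intro U hU i _ j _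
  simpa using entry_norm_bound_of_unitary hU i j

/-- The unit Haar measure on the unitary group `U(d)`. -/
def unitaryHaar (d : ℕ) : Measure (Matrix.unitaryGroup (Fin d) ℂ) := Measure.haarMeasure ⊤

/-- The local unitary `U_s ⊗ U_a`. -/
def localUnitary {d : ℕ} (Us Ua : Matrix.unitaryGroup (Fin d) ℂ) :
    Matrix.unitaryGroup (Fin d × Fin d) ℂ :=
  ⟨Us.1 ⊗ₖ Ua.1, Matrix.kronecker_mem_unitary Us.2 Ua.2⟩

variable {d : ℕ}

/-- The error averaged over local orientations. -/
def averageError (F : POVM X (Fin d × Fin d)) (Q : X → Herm (Fin d × Fin d)) (N : ℕ)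
    (σ : QState (Fin d × Fin d)) : ℝ≥0∞ :=
  ∫⁻ Us, ∫⁻ Ua, expectedError F Q N (σ.rotate (localUnitary Us Ua)) ∂unitaryHaar d ∂unitaryHaar d

/-- The worst-case error over local orientations. -/
def worstCaseError (F : POVM X (Fin d × Fin d)) (Q : X → Herm (Fin d × Fin d)) (N : ℕ)
    (σ : QState (Fin d × Fin d)) : ℝ≥0∞ :=
  ⨆ Us, ⨆ Ua, expectedError F Q N (σ.rotate (localUnitary Us Ua))

end Errors

end

noncomputable section

set_option linter.unusedSectionVars false

/-! ### Tight frames and their dual frames in a subspace -/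

section Frame

variable {E : Type*} [NormedAddCommGroup E] [InnerProductSpace ℝ E] [FiniteDimensional ℝ E]

/-! Write `D = d ^ 2`, `u` for the identity operator, and `V` for the span of the admissible states.
In all three cases these are the states lying in a subspace `W` that contains `u`, and `V = W`.

Averaging. For independent outcomes, `N` times the error at `ρ` is `∫ ‖Q‖² dp_ρ - tr ρ²`. Local
unitaries preserve the purity, and twirling over them turns every state into `u / D`, so the average
replaces `p_ρ` by `τ / D` (`averageError_add`). What remains is to minimise `∫ ‖Q‖² dτ`. By
linearity the reconstruction formula extends from states to `A = ∫ ⟪P, A⟫ Q dτ` for all `A ∈ V`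
(`IsReconstruction.isDualFamily`), so this is a problem about dual frames in a Euclidean space.

Lower bound. Only three facts about `P` matter: `‖P‖ ≤ 1`, `⟪P, u⟫ = 1` and `∫ P dτ = u`. The
reconstruction formula fixes `∫ ⟪Q, u⟫ dτ = D` and, by taking its trace, `∫ ⟪Q, P⟫ dτ = dim V`. Let
`Π` be the projector onto `V` and let `α` satisfy `dim V - 1 = α (D - 1)`. Completing the square
around `u / D + α (Π P - u / D)` gives (`integral_norm_sq_dual`) `∫ ‖Q‖² = 1 + α² (D - 1) + ∫ ‖Q -
(u / D + α (Π P - u / D))‖² + α² (D - ∫ ‖Π P‖²)`, and the last two terms are nonnegative.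

Equality. Both remainders vanish exactly when `P` lies in `V`, has norm one (rank one, since `P` is
positive with unit trace), and `Q = u / D + α (P - u / D)`. Inserting this `Q` into the
reconstruction formula shows that the frame operator is the identity on `u` and `α⁻¹` on the
traceless part of `V`; hence its support is `V`, the measurement is tight, and `Q` is the canonical
dual. Conversely, tightness with support `V` makes the canonical dual affine in `P`, and the trace
identity determines its slope. Then `‖Q‖` is constant almost everywhere, so the error is the same at
every point of the orbit and the worst case equals the average. -/

lemma supportProj_eq_of_symm_of_sq {T : E →L[ℝ] E} (hT : ∀ x y, ⟪T x, y⟫_ℝ = ⟪x, T y⟫_ℝ) {a : ℝ}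
    (ha : 0 < a) (hsq : ∀ x, T (T x) = a • T x) : T = a • supportProj T := by
  ext x
  have h : supportProj T x = a⁻¹ • T x := by
    refine Submodule.eq_starProjection_of_mem_of_inner_eq_zero
      (Submodule.smul_mem _ _ ⟨x, rfl⟩) ?_
    rintro _ ⟨y, rfl⟩
    change ⟪x - a⁻¹ • T x, T y⟫_ℝ = 0
    rw [← hT, map_sub, map_smul, hsq, smul_smul, inv_mul_cancel₀ ha.ne', one_smul, sub_self,
      inner_zero_left]
  change T x = a • supportProj T x
  rw [h, smul_smul, mul_inv_cancel₀ ha.ne', one_smul]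

variable {X : Type*} [MeasurableSpace X]

/-- The frame operator of a family of vectors. -/
def frameOperator (τ : Measure X) (P : X → E) : E →L[ℝ] E :=
  ∫ x, InnerProductSpace.rankOne ℝ (P x) (P x) ∂τ

/-- A family of vectors `P x` in the unit ball and in the affine hyperplane `⟪P x, u⟫ = 1`, whose
integral is `u`. -/
structure NormalizedFamily (τ : Measure X) (P : X → E) (u : E) : Prop where
  aestronglyMeasurable : AEStronglyMeasurable P τ
  norm_le : ∀ᵐ x ∂τ, ‖P x‖ ≤ 1
  inner_eq : ∀ᵐ x ∂τ, ⟪P x, u⟫_ℝ = 1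
  integral_eq : ∫ x, P x ∂τ = u
  ne_zero : u ≠ 0

/-- A family `Q` in `V` with `A = ∫ ⟪P, A⟫ Q` for all `A` in `V`. -/
structure IsDualFamily (τ : Measure X) (P : X → E) (V : Submodule ℝ E) (Q : X → E) : Prop where
  mem : ∀ x, Q x ∈ V
  integrable : Integrable Q τ
  reconstruct : ∀ A ∈ V, ∫ x, ⟪P x, A⟫_ℝ • Q x ∂τ = A

namespace NormalizedFamily

variable {τ : Measure X} [IsFiniteMeasure τ] {P : X → E} {u : E} (h : NormalizedFamily τ P u)

include h

lemma integrable : Integrable P τ :=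
  (memLp_top_of_bound h.aestronglyMeasurable 1 h.norm_le).integrable le_top

lemma memLp_two : MemLp P 2 τ :=
  (memLp_top_of_bound h.aestronglyMeasurable 1 h.norm_le).mono_exponent le_top

lemma inner_self_pos : 0 < ⟪u, u⟫_ℝ := real_inner_self_pos.mpr h.ne_zero

lemma measureReal_univ : τ.real Set.univ = ⟪u, u⟫_ℝ := by
  nth_rewrite 1 [← h.integral_eq]
  rw [real_inner_comm, ← integral_inner h.integrable]
  rw [integral_congr_ae (g := fun _ => (1 : ℝ))
    (h.inner_eq.mono fun x hx => by rw [real_inner_comm]; exact hx)]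
  simp

lemma integrable_inner_smul {G : Type*} [NormedAddCommGroup G] [NormedSpace ℝ G] {Q : X → G}
    (hQ : Integrable Q τ) (A : E) :
    Integrable (fun x => ⟪P x, A⟫_ℝ • Q x) τ := by
  refine hQ.bdd_smul ‖A‖ (h.aestronglyMeasurable.inner aestronglyMeasurable_const) ?_
  filter_upwards [h.norm_le] with x hx
  calc ‖⟪P x, A⟫_ℝ‖ ≤ ‖P x‖ * ‖A‖ := norm_inner_le_norm _ _
    _ ≤ 1 * ‖A‖ := by gcongr
    _ = ‖A‖ := one_mul _

lemma integrable_inner_left (A : E) : Integrable (fun x => ⟪P x, A⟫_ℝ) τ :=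
  h.integrable.inner_const A

lemma integrable_rankOne :
    Integrable (fun x => InnerProductSpace.rankOne ℝ (P x) (P x)) τ := by
  refine Integrable.of_bound (C := 1) ?_ ?_
  · have : Continuous fun v : E => InnerProductSpace.rankOne ℝ v v := by
      simp only [InnerProductSpace.rankOne_def]; fun_prop
    exact this.comp_aestronglyMeasurable h.aestronglyMeasurable
  · filter_upwards [h.norm_le] with x hx
    rw [InnerProductSpace.norm_rankOne]
    exact mul_le_one₀ hx (norm_nonneg _) hx

lemma frameOperator_apply (A : E) : frameOperator τ P A = ∫ x, ⟪P x, A⟫_ℝ • P x ∂τ := by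
  rw [frameOperator, ContinuousLinearMap.integral_apply h.integrable_rankOne]
  rfl

lemma frameOperator_one : frameOperator τ P u = u := by
  rw [h.frameOperator_apply]
  rw [integral_congr_ae (g := P) (h.inner_eq.mono fun x hx => by simp only [hx, one_smul])]
  exact h.integral_eq

lemma inner_frameOperator (A B : E) :
    ⟪frameOperator τ P A, B⟫_ℝ = ∫ x, ⟪P x, A⟫_ℝ * ⟪P x, B⟫_ℝ ∂τ := by
  rw [h.frameOperator_apply, real_inner_comm, ← integral_inner (h.integrable_inner_smul h.integrable A)]
  simp only [inner_smul_right, real_inner_comm]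

lemma frameOperator_symm (A B : E) :
    ⟪frameOperator τ P A, B⟫_ℝ = ⟪A, frameOperator τ P B⟫_ℝ := by
  rw [h.inner_frameOperator, real_inner_comm, h.inner_frameOperator]
  simp only [mul_comm]

/-- Since `P` integrates to `u` and pairs to one with `u`, the cross terms are themselves multiples
of the projector onto `u`: centering only removes the component along `u`. -/
lemma frameOperator_centered {P₀ : X → E} (hP₀ : ∀ᵐ x ∂τ, P₀ x = P x - (1 / ⟪u, u⟫_ℝ) • u) (A : E) :
    frameOperator τ P₀ A = frameOperator τ P A - (⟪u, A⟫_ℝ / ⟪u, u⟫_ℝ) • u := by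
  have hD := h.inner_self_pos.ne'
  have hm0 : AEStronglyMeasurable P₀ τ :=
    (h.aestronglyMeasurable.sub aestronglyMeasurable_const).congr (hP₀.mono fun x hx => hx.symm)
  have hint : Integrable (fun x => InnerProductSpace.rankOne ℝ (P₀ x) (P₀ x)) τ := by
    refine Integrable.of_bound (C := (1 + ‖(1 / ⟪u, u⟫_ℝ) • u‖) * (1 + ‖(1 / ⟪u, u⟫_ℝ) • u‖)) ?_ ?_
    · have : Continuous fun v : E => InnerProductSpace.rankOne ℝ v v := by
        simp only [InnerProductSpace.rankOne_def]; fun_prop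
      exact this.comp_aestronglyMeasurable hm0
    · filter_upwards [h.norm_le, hP₀] with x hx hx0
      have : ‖P₀ x‖ ≤ 1 + ‖(1 / ⟪u, u⟫_ℝ) • u‖ := by
        rw [hx0]; exact (norm_sub_le _ _).trans (by gcongr)
      rw [InnerProductSpace.norm_rankOne]
      gcongr
  rw [frameOperator, ContinuousLinearMap.integral_apply hint, h.frameOperator_apply]
  have key : ∀ᵐ x ∂τ, InnerProductSpace.rankOne ℝ (P₀ x) (P₀ x) A =
      ⟪P x, A⟫_ℝ • P x - ((⟪u, A⟫_ℝ / ⟪u, u⟫_ℝ) • P x +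
        ((1 / ⟪u, u⟫_ℝ) * ⟪P x, A⟫_ℝ) • u - ((1 / ⟪u, u⟫_ℝ) * (⟪u, A⟫_ℝ / ⟪u, u⟫_ℝ)) • u) := by
    filter_upwards [hP₀] with x hx
    rw [hx, InnerProductSpace.rankOne_apply, inner_sub_left, inner_smul_left]
    simp only [conj_trivial]
    module
  have i1 := h.integrable_inner_smul h.integrable A
  have i2 : Integrable (fun x => (⟪u, A⟫_ℝ / ⟪u, u⟫_ℝ) • P x) τ := h.integrable.smul _
  have i3 : Integrable (fun x => ((1 / ⟪u, u⟫_ℝ) * ⟪P x, A⟫_ℝ) • u) τ :=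
    ((h.integrable_inner_left A).const_mul _).smul_const _
  have i4 : Integrable (fun _ : X => ((1 / ⟪u, u⟫_ℝ) * (⟪u, A⟫_ℝ / ⟪u, u⟫_ℝ)) • u) τ :=
    integrable_const _
  rw [integral_congr_ae key, integral_sub i1 (by exact (i2.add i3).sub i4),
    integral_sub (by exact i2.add i3) i4, integral_add i2 i3, integral_smul, integral_smul_const,
    integral_const_mul, integral_const, h.integral_eq, h.measureReal_univ]
  have hA : ∫ x, ⟪P x, A⟫_ℝ ∂τ = ⟪u, A⟫_ℝ := by
    nth_rewrite 1 [← h.integral_eq]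
    rw [real_inner_comm, ← integral_inner h.integrable]
    simp only [real_inner_comm]
  rw [hA, smul_smul]
  congr 1
  rw [mul_comm (1 / ⟪u, u⟫_ℝ) ⟪u, A⟫_ℝ, mul_one_div, ← mul_assoc, mul_one_div_cancel hD, one_mul]
  abel

/-- The frame operator acts on `V` as the identity on `u` and as `a` on the complement of `u`. -/
lemma frameOperator_eq_of_isTight {P₀ : X → E}
    (hP₀ : ∀ᵐ x ∂τ, P₀ x = P x - (1 / ⟪u, u⟫_ℝ) • u) {a : ℝ}
    (ht : frameOperator τ P₀ = a • supportProj (frameOperator τ P₀)) {A : E}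
    (hA : A ∈ opSupport (frameOperator τ P)) :
    frameOperator τ P A = a • A + ((1 - a) * (⟪u, A⟫_ℝ / ⟪u, u⟫_ℝ)) • u := by
  have hD := h.inner_self_pos.ne'
  set G := frameOperator τ P with hG
  have hu : u ∈ opSupport G := ⟨u, h.frameOperator_one⟩
  have hsq (B : E) : frameOperator τ P₀ (frameOperator τ P₀ B) = a • frameOperator τ P₀ B := by
    refine (congrArg (fun L : E →L[ℝ] E => L (frameOperator τ P₀ B)) ht).trans ?_
    change a • supportProj (frameOperator τ P₀) (frameOperator τ P₀ B) = _
    congr 1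
    exact Submodule.starProjection_eq_self_iff.mpr ⟨B, rfl⟩
  have h0 (B : E) (hB : ⟪u, B⟫_ℝ = 0) : frameOperator τ P₀ B = G B := by
    rw [h.frameOperator_centered hP₀, hB]; simp [hG]
  have huG (B : E) : ⟪u, G B⟫_ℝ = ⟪u, B⟫_ℝ := by
    rw [hG, ← h.frameOperator_symm, h.frameOperator_one]
  have key (B : E) (hB : ⟪u, B⟫_ℝ = 0) (hBm : B ∈ opSupport G) : G B = a • B := by
    have h1 : G (G B) = a • G B := by
      have := hsq B
      rwa [h0 B hB, h0 (G B) (by rw [huG, hB])] at this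
    -- Tightness is an identity on the range of the centered operator and gives only `G (G B) = a •
    -- G B`. So `G B - a • B` lies both in the range and in the kernel of the symmetric operator
    -- `G`; these are orthogonal, and the vector is zero.
    obtain ⟨C, hC⟩ : G B - a • B ∈ opSupport G :=
      Submodule.sub_mem _ ⟨B, rfl⟩ (Submodule.smul_mem _ _ hBm)
    have hC' : G C = G B - a • B := hC
    have : ⟪G C, G C⟫_ℝ = 0 := by
      nth_rewrite 1 [hG]
      rw [h.frameOperator_symm, ← hG, hC', map_sub, map_smul, h1, sub_self, inner_zero_right]
    rw [inner_self_eq_zero, hC', sub_eq_zero] at this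
    exact this
  have hdec := key (A - (⟪u, A⟫_ℝ / ⟪u, u⟫_ℝ) • u)
    (by rw [inner_sub_right, inner_smul_right, div_mul_cancel₀ _ hD, sub_self])
    (Submodule.sub_mem _ hA (Submodule.smul_mem _ _ hu))
  rw [map_sub, map_smul, hG, h.frameOperator_one, sub_eq_iff_eq_add] at hdec
  rw [hG, hdec]
  module

/-- For `A` orthogonal to the range, `∫ ⟪P, A⟫² = ⟪G A, A⟫ = 0` with `G` the frame operator. Running
over a finite basis of the complement leaves a single null set that serves all `A`. -/
lemma ae_mem_opSupport : ∀ᵐ x ∂τ, P x ∈ opSupport (frameOperator τ P) := by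
  set G := frameOperator τ P with hG
  have h1 (A : E) (hA : A ∈ (opSupport G)ᗮ) : ∀ᵐ x ∂τ, ⟪P x, A⟫_ℝ = 0 := by
    have h2 : ∫ x, ⟪P x, A⟫_ℝ * ⟪P x, A⟫_ℝ ∂τ = 0 := by
      rw [← h.inner_frameOperator]
      exact (Submodule.mem_orthogonal _ _).mp hA _ ⟨A, rfl⟩
    rw [integral_eq_zero_iff_of_nonneg (fun x => mul_self_nonneg _)] at h2
    · filter_upwards [h2] with x hx
      exact mul_self_eq_zero.mp hx
    · exact h.integrable_inner_smul (h.integrable_inner_left A) A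
  have h3 := ae_all_iff.mpr fun k =>
    h1 (stdOrthonormalBasis ℝ (opSupport G)ᗮ k : E) (stdOrthonormalBasis ℝ (opSupport G)ᗮ k).2
  filter_upwards [h3] with x hx
  rw [← Submodule.orthogonal_orthogonal (opSupport G), Submodule.mem_orthogonal]
  intro A hA
  have h4 := congrArg Subtype.val ((stdOrthonormalBasis ℝ (opSupport G)ᗮ).sum_repr ⟨A, hA⟩)
  simp only [Submodule.coe_sum, Submodule.coe_smul] at h4
  rw [← h4, sum_inner]
  refine Finset.sum_eq_zero fun k _ => ?_
  rw [inner_smul_left, real_inner_comm, hx k, mul_zero]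

/-- A frame operator acting as a multiple of the identity on the part of `V` orthogonal to `u`
has support `V`, is tight, and has an explicit dual. -/
lemma isTight_of_frameOperator_eq {V : Submodule ℝ E} (hu : u ∈ V) (hPV : ∀ᵐ x ∂τ, P x ∈ V)
    {P₀ : X → E} (hP₀ : ∀ᵐ x ∂τ, P₀ x = P x - (1 / ⟪u, u⟫_ℝ) • u)
    {a : ℝ} (ha : 0 < a)
    (hG : ∀ A ∈ V, frameOperator τ P A = a • A + ((1 - a) * (⟪u, A⟫_ℝ / ⟪u, u⟫_ℝ)) • u) :
    opSupport (frameOperator τ P) = V ∧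
      frameOperator τ P₀ = a • supportProj (frameOperator τ P₀) := by
  have hD := h.inner_self_pos.ne'
  have hsymm (A B : E) : ⟪frameOperator τ P₀ A, B⟫_ℝ = ⟪A, frameOperator τ P₀ B⟫_ℝ := by
    rw [h.frameOperator_centered hP₀, h.frameOperator_centered hP₀, inner_sub_left, inner_sub_right,
      h.frameOperator_symm, inner_smul_left, inner_smul_right, conj_trivial, real_inner_comm u A]
    ring
  have hproj (A : E) : frameOperator τ P A = frameOperator τ P (V.starProjection A) := by
    rw [h.frameOperator_apply, h.frameOperator_apply]
    refine integral_congr_ae ?_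
    filter_upwards [hPV] with x hx
    have : ⟪P x, A⟫_ℝ = ⟪P x, V.starProjection A⟫_ℝ := by
      rw [← Submodule.inner_starProjection_left_eq_right, Submodule.starProjection_eq_self_iff.mpr hx]
    rw [this]
  have huproj (A : E) : ⟪u, V.starProjection A⟫_ℝ = ⟪u, A⟫_ℝ := by
    rw [← Submodule.inner_starProjection_left_eq_right, Submodule.starProjection_eq_self_iff.mpr hu]
  constructor
  · apply le_antisymm
    · rintro _ ⟨A, rfl⟩
      change frameOperator τ P A ∈ V
      have hmem := Submodule.starProjection_apply_mem V A
      rw [hproj, hG _ hmem]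
      exact V.add_mem (V.smul_mem _ hmem) (V.smul_mem _ hu)
    · intro A hA
      -- The preimage is found by inverting separately on the two eigenspaces: factor `a⁻¹` on the
      -- part orthogonal to `u`, factor one along `u`.
      refine ⟨a⁻¹ • (A - (⟪u, A⟫_ℝ / ⟪u, u⟫_ℝ) • u) + (⟪u, A⟫_ℝ / ⟪u, u⟫_ℝ) • u, ?_⟩
      change frameOperator τ P _ = A
      rw [map_add, map_smul, map_smul, map_sub, map_smul, h.frameOperator_one, hG A hA]
      have : a⁻¹ • (a • A + ((1 - a) * (⟪u, A⟫_ℝ / ⟪u, u⟫_ℝ)) • u - (⟪u, A⟫_ℝ / ⟪u, u⟫_ℝ) • u) =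
          (a⁻¹ * a) • (A - (⟪u, A⟫_ℝ / ⟪u, u⟫_ℝ) • u) := by module
      rw [this, inv_mul_cancel₀ ha.ne', one_smul, sub_add_cancel]
  · refine supportProj_eq_of_symm_of_sq hsymm ha fun A => ?_
    have h1 : frameOperator τ P₀ A =
        a • (V.starProjection A - (⟪u, A⟫_ℝ / ⟪u, u⟫_ℝ) • u) := by
      rw [h.frameOperator_centered hP₀, hproj, hG _ (Submodule.starProjection_apply_mem V A), huproj]
      module
    have hmem : frameOperator τ P₀ A ∈ V := by
      rw [h1]
      exact V.smul_mem _ (V.sub_mem (Submodule.starProjection_apply_mem V A) (V.smul_mem _ hu))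
    have hz : ⟪u, frameOperator τ P₀ A⟫_ℝ = 0 := by
      rw [h1, inner_smul_right, inner_sub_right, huproj, inner_smul_right, div_mul_cancel₀ _ hD,
        sub_self, mul_zero]
    rw [h.frameOperator_centered hP₀ (frameOperator τ P₀ A), hG _ hmem, hz]
    simp

/-- The canonical dual of a tight family. -/
lemma supportInverse_apply_of_frameOperator_eq {V : Submodule ℝ E} (hu : u ∈ V)
    {a : ℝ} (ha : 0 < a) {S : E →L[ℝ] E} (hS : IsSupportInverse (frameOperator τ P) S)
    (hV : opSupport (frameOperator τ P) = V)
    (hG : ∀ A ∈ V, frameOperator τ P A = a • A + ((1 - a) * (⟪u, A⟫_ℝ / ⟪u, u⟫_ℝ)) • u)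
    {A : E} (hA : A ∈ V) (hA1 : ⟪A, u⟫_ℝ = 1) :
    S A = (1 / ⟪u, u⟫_ℝ) • u + a⁻¹ • (A - (1 / ⟪u, u⟫_ℝ) • u) := by
  -- `B` is the preimage of `A` under the frame operator inside `V`, so `S A` is the projection of
  -- `B` to the support, which is `B`.
  set B := (1 / ⟪u, u⟫_ℝ) • u + a⁻¹ • (A - (1 / ⟪u, u⟫_ℝ) • u) with hB
  have hBV : B ∈ V :=
    V.add_mem (V.smul_mem _ hu) (V.smul_mem _ (V.sub_mem hA (V.smul_mem _ hu)))
  have hGB : frameOperator τ P B = A := by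
    rw [hB, map_add, map_smul, map_smul, map_sub, map_smul, h.frameOperator_one, hG A hA,
      real_inner_comm A u, hA1]
    have : a⁻¹ • (a • A + ((1 - a) * (1 / ⟪u, u⟫_ℝ)) • u - (1 / ⟪u, u⟫_ℝ) • u) =
        (a⁻¹ * a) • (A - (1 / ⟪u, u⟫_ℝ) • u) := by module
    rw [this, inv_mul_cancel₀ ha.ne', one_smul, add_sub_cancel]
  have h1 : S (frameOperator τ P B) = supportProj (frameOperator τ P) B :=
    congrArg (fun L : E →L[ℝ] E => L B) hS.2.1
  rw [hGB] at h1
  rw [h1]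
  exact Submodule.starProjection_eq_self_iff.mpr (hV ▸ hBV)

end NormalizedFamily

end Frame

/-! ### Lower bound for the second moment of a dual family -/

section FrameBound

variable {E : Type*} [NormedAddCommGroup E] [InnerProductSpace ℝ E] [FiniteDimensional ℝ E]
  {X : Type*} [MeasurableSpace X]

lemma lintegral_ofReal_norm_sq_eq {τ : Measure X} {Q : X → E} (hQ : MemLp Q 2 τ) :
    ∫⁻ x, ENNReal.ofReal (‖Q x‖ ^ 2) ∂τ = ENNReal.ofReal (∫ x, ‖Q x‖ ^ 2 ∂τ) :=
  (ofReal_integral_eq_lintegral_ofReal hQ.norm.integrable_sq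
    (Filter.Eventually.of_forall fun _ => sq_nonneg _)).symm

lemma memLp_two_of_lintegral_ne_top {τ : Measure X} {Q : X → E} (hQ : AEStronglyMeasurable Q τ)
    (h : ∫⁻ x, ENNReal.ofReal (‖Q x‖ ^ 2) ∂τ ≠ ∞) : MemLp Q 2 τ := by
  rw [memLp_two_iff_integrable_sq_norm hQ]
  refine ⟨hQ.norm.pow 2, ?_⟩
  rw [hasFiniteIntegral_iff_ofReal (Filter.Eventually.of_forall fun _ => sq_nonneg _)]
  exact h.lt_top

namespace NormalizedFamily

variable {τ : Measure X} [IsFiniteMeasure τ] {P : X → E} {u : E} (h : NormalizedFamily τ P u)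
  {V : Submodule ℝ E} {Q : X → E} (hQ : IsDualFamily τ P V Q)

include h hQ

lemma integral_dual (hu : u ∈ V) : ∫ x, Q x ∂τ = u := by
  conv_rhs => rw [← hQ.reconstruct u hu]
  refine integral_congr_ae ?_
  filter_upwards [h.inner_eq] with x hx
  rw [hx, one_smul]

lemma integral_inner_dual_one (hu : u ∈ V) : ∫ x, ⟪Q x, u⟫_ℝ ∂τ = ⟪u, u⟫_ℝ := by
  simp only [real_inner_comm u]
  rw [integral_inner hQ.integrable, h.integral_dual hQ hu]

/-- Each summand is a coordinate of an integrand of the reconstruction formula, for a basis vector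
of `V`. This supplies both the integrability and the integral of `⟪Q, P⟫`. -/
lemma inner_dual_eq_sum (x : X) : ⟪Q x, P x⟫_ℝ =
    ∑ k, ⟪(stdOrthonormalBasis ℝ V k : E), ⟪P x, stdOrthonormalBasis ℝ V k⟫_ℝ • Q x⟫_ℝ := by
  have h4 := congrArg Subtype.val ((stdOrthonormalBasis ℝ V).sum_repr' ⟨Q x, hQ.mem x⟩)
  simp only [Submodule.coe_sum, Submodule.coe_smul, Submodule.coe_inner] at h4
  conv_lhs => rw [← h4]
  rw [sum_inner]
  refine Finset.sum_congr rfl fun k _ => ?_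
  rw [inner_smul_left, inner_smul_right, conj_trivial, real_inner_comm (P x), mul_comm]

lemma integrable_inner_dual : Integrable (fun x => ⟪Q x, P x⟫_ℝ) τ := by
  simp only [h.inner_dual_eq_sum hQ]
  exact integrable_finsetSum _ fun k _ => (h.integrable_inner_smul hQ.integrable _).const_inner _

/-- The reconstruction formula says that `∫ |Q⟩⟨P|` is the identity on `V`; this is its trace. -/
lemma integral_inner_dual : ∫ x, ⟪Q x, P x⟫_ℝ ∂τ = Module.finrank ℝ V := by
  simp only [h.inner_dual_eq_sum hQ]
  rw [integral_finsetSum _ fun k _ => (h.integrable_inner_smul hQ.integrable _).const_inner _]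
  have hone (k : Fin (Module.finrank ℝ V)) : ∫ x, ⟪(stdOrthonormalBasis ℝ V k : E),
      ⟪P x, stdOrthonormalBasis ℝ V k⟫_ℝ • Q x⟫_ℝ ∂τ = 1 := by
    rw [integral_inner (h.integrable_inner_smul hQ.integrable _),
      hQ.reconstruct _ (stdOrthonormalBasis ℝ V k).2, ← Submodule.coe_inner]
    simp
  simp [hone]

omit hQ in
lemma inner_eq_inner_proj (hu : u ∈ V) (x : X) : ⟪V.starProjection (P x), u⟫_ℝ = ⟪P x, u⟫_ℝ := by
  rw [Submodule.inner_starProjection_left_eq_right, Submodule.starProjection_eq_self_iff.mpr hu]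

omit hQ in
lemma memLp_two_proj : MemLp (fun x => V.starProjection (P x)) 2 τ :=
  h.memLp_two.of_le (V.starProjection.continuous.comp_aestronglyMeasurable h.aestronglyMeasurable)
    (Filter.Eventually.of_forall fun x => Submodule.norm_starProjection_apply_le V (P x))

omit hQ in
lemma memLp_two_affine (α : ℝ) :
    MemLp (fun x => (1 / ⟪u, u⟫_ℝ) • u + α • (V.starProjection (P x) - (1 / ⟪u, u⟫_ℝ) • u)) 2 τ := by
  have h1 : MemLp (fun _ : X => (1 / ⟪u, u⟫_ℝ) • u) 2 τ := memLp_const _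
  have h2 : MemLp (fun x => V.starProjection (P x) - (1 / ⟪u, u⟫_ℝ) • u) 2 τ :=
    h.memLp_two_proj.sub h1
  exact h1.add (h2.const_smul α)

/-- The second moment of a dual family, in terms of its distance to an affine image of the
projected family. -/
lemma integral_norm_sq_dual (hu : u ∈ V) (hL : MemLp Q 2 τ) {α : ℝ}
    (hα : (Module.finrank ℝ V : ℝ) - 1 = α * (⟪u, u⟫_ℝ - 1)) :
    ∫ x, ‖Q x‖ ^ 2 ∂τ = 1 + α ^ 2 * (⟪u, u⟫_ℝ - 1) +
      ∫ x, ‖Q x - ((1 / ⟪u, u⟫_ℝ) • u +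
        α • (V.starProjection (P x) - (1 / ⟪u, u⟫_ℝ) • u))‖ ^ 2 ∂τ +
      α ^ 2 * (⟪u, u⟫_ℝ - ∫ x, ‖V.starProjection (P x)‖ ^ 2 ∂τ) := by
  set D := ⟪u, u⟫_ℝ with hDdef
  have hD : D ≠ 0 := h.inner_self_pos.ne'
  -- `W` is the candidate optimum. The slope `α` is the one for which `∫ ⟪W, P⟫` takes the value
  -- `dim V` forced on any dual when `‖V.starProjection (P x)‖ = 1` almost everywhere.
  set W : X → E := fun x => (1 / D) • u + α • (V.starProjection (P x) - (1 / D) • u) with hW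
  have hWL : MemLp W 2 τ := h.memLp_two_affine α
  have hQP (x : X) : ⟪Q x, V.starProjection (P x)⟫_ℝ = ⟪Q x, P x⟫_ℝ := by
    rw [← Submodule.inner_starProjection_left_eq_right,
      Submodule.starProjection_eq_self_iff.mpr (hQ.mem x)]
  have key : ∀ᵐ x ∂τ, ‖Q x‖ ^ 2 = ‖Q x - W x‖ ^ 2 + (2 * ((1 - α) / D) * ⟪Q x, u⟫_ℝ +
      (2 * α * ⟪Q x, P x⟫_ℝ - (α ^ 2 * ‖V.starProjection (P x)‖ ^ 2 +
        (1 / D) * (2 * α * (1 - α) + (1 - α) ^ 2)))) := by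
    filter_upwards [h.inner_eq] with x hx
    have h1 : W x = ((1 - α) / D) • u + α • V.starProjection (P x) := by
      simp only [hW]; module
    have h2 : ‖W x‖ ^ 2 = α ^ 2 * ‖V.starProjection (P x)‖ ^ 2 +
        (1 / D) * (2 * α * (1 - α) + (1 - α) ^ 2) := by
      rw [h1, norm_add_sq_real, norm_smul, norm_smul, mul_pow, mul_pow, ← real_inner_self_eq_norm_sq u,
        inner_smul_left, inner_smul_right, real_inner_comm (V.starProjection (P x)) u, h.inner_eq_inner_proj hu, hx,
        Real.norm_eq_abs, Real.norm_eq_abs, sq_abs, sq_abs, ← hDdef, conj_trivial]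
      field_simp
      ring
    rw [← h2, norm_sub_sq_real, h1, inner_add_right, inner_smul_right, inner_smul_right, hQP]
    ring
  have i0 := hL.sub hWL
  have i1 : Integrable (fun x => ‖Q x - W x‖ ^ 2) τ := i0.norm.integrable_sq
  have i2 : Integrable (fun x => 2 * ((1 - α) / D) * ⟪Q x, u⟫_ℝ) τ :=
    (hQ.integrable.inner_const u).const_mul _
  have i3 : Integrable (fun x => 2 * α * ⟪Q x, P x⟫_ℝ) τ :=
    (h.integrable_inner_dual hQ).const_mul _
  have i4 : Integrable (fun x => α ^ 2 * ‖V.starProjection (P x)‖ ^ 2) τ :=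
    h.memLp_two_proj.norm.integrable_sq.const_mul _
  have i5 : Integrable (fun _ : X => (1 / D) * (2 * α * (1 - α) + (1 - α) ^ 2)) τ :=
    integrable_const _
  rw [integral_congr_ae key, integral_add i1 (by exact i2.add (i3.sub (i4.add i5))),
    integral_add i2 (by exact i3.sub (i4.add i5)), integral_sub i3 (by exact i4.add i5),
    integral_add i4 i5, integral_const_mul, integral_const_mul, integral_const_mul, integral_const,
    h.integral_inner_dual hQ, h.integral_inner_dual_one hQ hu, h.measureReal_univ, ← hDdef,
    sub_eq_iff_eq_add.mp hα, smul_eq_mul]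
  have : D * ((1 / D) * (2 * α * (1 - α) + (1 - α) ^ 2)) = 2 * α * (1 - α) + (1 - α) ^ 2 := by
    field_simp
  rw [this]
  have : 2 * ((1 - α) / D) * D = 2 * (1 - α) := by field_simp
  rw [this]
  ring

omit hQ in
lemma integral_norm_sq_proj_le : ∫ x, ‖V.starProjection (P x)‖ ^ 2 ∂τ ≤ ⟪u, u⟫_ℝ := by
  calc ∫ x, ‖V.starProjection (P x)‖ ^ 2 ∂τ ≤ ∫ _, (1 : ℝ) ∂τ := by
        refine integral_mono_ae h.memLp_two_proj.norm.integrable_sq (integrable_const _) ?_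
        filter_upwards [h.norm_le] with x hx
        exact pow_le_one₀ (norm_nonneg _) ((Submodule.norm_starProjection_apply_le V (P x)).trans hx)
    _ = ⟪u, u⟫_ℝ := by simp [h.measureReal_univ]

lemma le_lintegral_norm_sq_dual (hu : u ∈ V) {α : ℝ}
    (hα : (Module.finrank ℝ V : ℝ) - 1 = α * (⟪u, u⟫_ℝ - 1)) :
    ENNReal.ofReal (1 + α ^ 2 * (⟪u, u⟫_ℝ - 1)) ≤ ∫⁻ x, ENNReal.ofReal (‖Q x‖ ^ 2) ∂τ := by
  by_cases hfin : ∫⁻ x, ENNReal.ofReal (‖Q x‖ ^ 2) ∂τ = ∞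
  · rw [hfin]; exact le_top
  have hL := memLp_two_of_lintegral_ne_top hQ.integrable.aestronglyMeasurable hfin
  rw [lintegral_ofReal_norm_sq_eq hL, h.integral_norm_sq_dual hQ hu hL hα]
  apply ENNReal.ofReal_le_ofReal
  have h1 := mul_nonneg (sq_nonneg α)
    (sub_nonneg.mpr (h.integral_norm_sq_proj_le (V := V)))
  have h2 : 0 ≤ ∫ x, ‖Q x - ((1 / ⟪u, u⟫_ℝ) • u +
      α • (V.starProjection (P x) - (1 / ⟪u, u⟫_ℝ) • u))‖ ^ 2 ∂τ :=
    integral_nonneg fun _ => sq_nonneg _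
  linarith

/-- Both nonnegative remainders in `integral_norm_sq_dual` have to vanish. One makes `Q` affine in
the projection of `P`; the other, after division by `α ^ 2`, makes that projection of norm one. As
`‖P‖ ≤ 1`, the projection then loses no norm, so `P` already lies in `V`. -/
lemma ae_of_lintegral_norm_sq_dual_eq (hu : u ∈ V) {α : ℝ} (hα0 : 0 < α) (hD1 : 1 ≤ ⟪u, u⟫_ℝ)
    (hα : (Module.finrank ℝ V : ℝ) - 1 = α * (⟪u, u⟫_ℝ - 1))
    (heq : ∫⁻ x, ENNReal.ofReal (‖Q x‖ ^ 2) ∂τ = ENNReal.ofReal (1 + α ^ 2 * (⟪u, u⟫_ℝ - 1))) :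
    ∀ᵐ x ∂τ, P x ∈ V ∧ ‖P x‖ = 1 ∧
      Q x = (1 / ⟪u, u⟫_ℝ) • u + α • (P x - (1 / ⟪u, u⟫_ℝ) • u) := by
  have hL := memLp_two_of_lintegral_ne_top hQ.integrable.aestronglyMeasurable
    (heq ▸ ENNReal.ofReal_ne_top)
  rw [lintegral_ofReal_norm_sq_eq hL, ENNReal.ofReal_eq_ofReal_iff
    (integral_nonneg fun _ => sq_nonneg _)
    (by have := mul_nonneg (sq_nonneg α) (sub_nonneg.mpr hD1); linarith),
    h.integral_norm_sq_dual hQ hu hL hα] at heq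
  have h0 := h.integral_norm_sq_proj_le (V := V)
  have h1 := mul_nonneg (sq_nonneg α) (sub_nonneg.mpr h0)
  have h2 : 0 ≤ ∫ x, ‖Q x - ((1 / ⟪u, u⟫_ℝ) • u +
      α • (V.starProjection (P x) - (1 / ⟪u, u⟫_ℝ) • u))‖ ^ 2 ∂τ :=
    integral_nonneg fun _ => sq_nonneg _
  have h3 : ∫ x, ‖Q x - ((1 / ⟪u, u⟫_ℝ) • u +
      α • (V.starProjection (P x) - (1 / ⟪u, u⟫_ℝ) • u))‖ ^ 2 ∂τ = 0 := by linarith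
  have h4 : α ^ 2 * (⟪u, u⟫_ℝ - ∫ x, ‖V.starProjection (P x)‖ ^ 2 ∂τ) = 0 := by linarith
  have h5 : ∫ x, (1 - ‖V.starProjection (P x)‖ ^ 2) ∂τ = 0 := by
    rw [integral_sub (integrable_const _) h.memLp_two_proj.norm.integrable_sq]
    simpa [h.measureReal_univ, hα0.ne'] using h4
  rw [integral_eq_zero_iff_of_nonneg (fun _ => sq_nonneg _)] at h3
  · rw [integral_eq_zero_iff_of_nonneg_ae] at h5
    · filter_upwards [h3, h5, h.norm_le] with x hx3 hx5 hx
      have h6 : ‖V.starProjection (P x)‖ = 1 := by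
        have : ‖V.starProjection (P x)‖ ^ 2 = 1 := (sub_eq_zero.mp hx5).symm
        exact (pow_eq_one_iff_of_nonneg (norm_nonneg _) two_ne_zero).mp this
      have h7 := Submodule.norm_starProjection_apply_le V (P x)
      have h8 : ‖P x‖ = 1 := le_antisymm hx (h6 ▸ h7)
      have h9 : V.starProjection (P x) = P x := by
        rw [Submodule.starProjection_eq_self_iff, Submodule.mem_iff_norm_starProjection, h6, h8]
      refine ⟨Submodule.starProjection_eq_self_iff.mp h9, h8, ?_⟩
      rw [h9] at hx3
      exact sub_eq_zero.mp (norm_eq_zero.mp (pow_eq_zero_iff two_ne_zero |>.mp hx3))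
    · filter_upwards [h.norm_le] with x hx
      exact sub_nonneg.mpr (pow_le_one₀ (norm_nonneg _)
        ((Submodule.norm_starProjection_apply_le V (P x)).trans hx))
    · exact (integrable_const _).sub h.memLp_two_proj.norm.integrable_sq
  · have h6 := hL.sub (h.memLp_two_affine (V := V) α)
    exact h6.norm.integrable_sq

/-- A dual family that is affine in `P` determines the frame operator on `V`. -/
lemma frameOperator_eq_of_dual_eq {α : ℝ} (hα0 : 0 < α)
    (hae : ∀ᵐ x ∂τ, Q x = (1 / ⟪u, u⟫_ℝ) • u + α • (P x - (1 / ⟪u, u⟫_ℝ) • u)) {A : E}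
    (hA : A ∈ V) :
    frameOperator τ P A = α⁻¹ • A + ((1 - α⁻¹) * (⟪u, A⟫_ℝ / ⟪u, u⟫_ℝ)) • u := by
  -- With `Q` affine in `P`, the reconstruction formula becomes a linear equation between `A`, `u`
  -- and the frame operator at `A`, which is solved for the latter below.
  have h1 : A = ((1 - α) * (⟪u, A⟫_ℝ / ⟪u, u⟫_ℝ)) • u + α • frameOperator τ P A := by
    conv_lhs => rw [← hQ.reconstruct A hA]
    rw [integral_congr_ae (g := fun x =>
      (⟪P x, A⟫_ℝ * ((1 - α) / ⟪u, u⟫_ℝ)) • u + α • (⟪P x, A⟫_ℝ • P x))]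
    · rw [integral_add (((h.integrable_inner_left A).mul_const _).smul_const _)
        (by exact (h.integrable_inner_smul h.integrable A).smul α), integral_smul_const,
        integral_mul_const, integral_smul, ← h.frameOperator_apply]
      have hA : ∫ x, ⟪P x, A⟫_ℝ ∂τ = ⟪u, A⟫_ℝ := by
        conv_rhs => rw [← h.integral_eq]
        rw [real_inner_comm, ← integral_inner h.integrable]
        simp only [real_inner_comm]
      rw [hA]
      congr 2
      ring
    · filter_upwards [hae] with x hx
      rw [hx]
      module
  have h2 : α • frameOperator τ P A = A - ((1 - α) * (⟪u, A⟫_ℝ / ⟪u, u⟫_ℝ)) • u := by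
    rw [eq_sub_iff_add_eq, add_comm]; exact h1.symm
  have h3 : frameOperator τ P A = α⁻¹ • (α • frameOperator τ P A) := by
    rw [smul_smul, inv_mul_cancel₀ hα0.ne', one_smul]
  rw [h3, h2, smul_sub, sub_eq_add_neg, smul_smul, ← neg_smul]
  congr 2
  have : α⁻¹ * α = 1 := inv_mul_cancel₀ hα0.ne'
  linear_combination (⟪u, A⟫_ℝ / ⟪u, u⟫_ℝ) * this

omit hQ in
/-- The squared norm of an affine image of a unit vector in the hyperplane `⟪·, u⟫ = 1`. -/
lemma norm_sq_affine {v : E} (hv : ‖v‖ = 1) (hv1 : ⟪v, u⟫_ℝ = 1) (β : ℝ) :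
    ‖(1 / ⟪u, u⟫_ℝ) • u + β • (v - (1 / ⟪u, u⟫_ℝ) • u)‖ ^ 2 =
      (1 + β ^ 2 * (⟪u, u⟫_ℝ - 1)) / ⟪u, u⟫_ℝ := by
  have hD : ⟪u, u⟫_ℝ ≠ 0 := h.inner_self_pos.ne'
  have hvv : ⟪v, v⟫_ℝ = 1 := by rw [real_inner_self_eq_norm_sq, hv, one_pow]
  have huv : ⟪u, v⟫_ℝ = 1 := by rw [real_inner_comm, hv1]
  rw [← real_inner_self_eq_norm_sq]
  simp only [inner_add_left, inner_add_right, inner_smul_left, inner_smul_right, inner_sub_left,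
    inner_sub_right, conj_trivial, hvv, huv, hv1]
  field_simp
  ring

/-- For a dual family that is affine in `P` with slope `β`, the slope is determined by the
dimension of `V`. -/
lemma slope_mul_eq_of_dual_eq {β : ℝ} (hP : ∀ᵐ x ∂τ, ‖P x‖ = 1)
    (hae : ∀ᵐ x ∂τ, Q x = (1 / ⟪u, u⟫_ℝ) • u + β • (P x - (1 / ⟪u, u⟫_ℝ) • u)) :
    (Module.finrank ℝ V : ℝ) - 1 = β * (⟪u, u⟫_ℝ - 1) := by
  have hD : ⟪u, u⟫_ℝ ≠ 0 := h.inner_self_pos.ne'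
  rw [← h.integral_inner_dual hQ, integral_congr_ae
    (g := fun _ => 1 / ⟪u, u⟫_ℝ + β * (1 - 1 / ⟪u, u⟫_ℝ)), integral_const, h.measureReal_univ,
    smul_eq_mul]
  · field_simp
    ring
  · filter_upwards [hP, hae, h.inner_eq] with x h1 h2 h3
    have hvv : ⟪P x, P x⟫_ℝ = 1 := by rw [real_inner_self_eq_norm_sq, h1, one_pow]
    have huv : ⟪u, P x⟫_ℝ = 1 := by rw [real_inner_comm, h3]
    rw [h2]
    simp only [inner_add_left, inner_smul_left, inner_sub_left, conj_trivial, hvv, huv]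
    ring

end NormalizedFamily

end FrameBound

/-! ### Positive semidefinite operators of unit trace -/

namespace Herm

variable {n : Type*} [Fintype n]

lemma inner_eq_trace_mul (A B : Herm n) : ⟪A, B⟫_ℝ = (A.mat * B.mat).trace.re := by
  rw [inner_def, A.isHermitian.eq]

lemma inner_one [DecidableEq n] (A : Herm n) : ⟪A, one⟫_ℝ = A.mat.trace.re := by
  simp [inner_eq_trace_mul, one]

lemma inner_one_one [DecidableEq n] : ⟪(one : Herm n), one⟫_ℝ = Fintype.card n := by
  rw [inner_one]
  simp [one]

lemma im_trace (A : Herm n) : A.mat.trace.im = 0 := by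
  have h : star A.mat.trace = A.mat.trace := by
    rw [← trace_conjTranspose, A.isHermitian.eq]
  exact Complex.conj_eq_iff_im.mp h

lemma trace_eq_inner_one [DecidableEq n] (A : Herm n) : A.mat.trace = (⟪A, one⟫_ℝ : ℝ) := by
  rw [inner_one]
  exact Complex.ext rfl (by simp [A.im_trace])

variable [DecidableEq n]

lemma norm_sq_eq_sum_eigenvalues (A : Herm n) :
    ‖A‖ ^ 2 = ∑ i, A.isHermitian.eigenvalues i ^ 2 := by
  rw [← real_inner_self_eq_norm_sq, inner_eq_trace_mul]
  set U := A.isHermitian.eigenvectorUnitary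
  set Λ : Matrix n n ℂ := diagonal (RCLike.ofReal ∘ A.isHermitian.eigenvalues)
  have hA : A.mat = (U : Matrix n n ℂ) * Λ * star (U : Matrix n n ℂ) := by
    conv_lhs => rw [A.isHermitian.spectral_theorem]
    rfl
  have hU : star (U : Matrix n n ℂ) * U = 1 := Matrix.UnitaryGroup.star_mul_self U
  have h1 : A.mat * A.mat = (U : Matrix n n ℂ) * (Λ * Λ) * star (U : Matrix n n ℂ) := by
    rw [hA]
    calc _ = (U : Matrix n n ℂ) * Λ * (star (U : Matrix n n ℂ) * U) * Λ *
        star (U : Matrix n n ℂ) := by simp only [Matrix.mul_assoc]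
      _ = _ := by rw [hU, Matrix.mul_one]; simp only [Matrix.mul_assoc]
  rw [h1, Matrix.trace_mul_cycle, hU, Matrix.one_mul, Matrix.diagonal_mul_diagonal,
    Matrix.trace_diagonal, Complex.re_sum]
  refine Finset.sum_congr rfl fun i _ => ?_
  simp [sq]

lemma sum_eigenvalues (A : Herm n) : ∑ i, A.isHermitian.eigenvalues i = ⟪A, one⟫_ℝ := by
  rw [inner_one, A.isHermitian.trace_eq_sum_eigenvalues, Complex.re_sum]
  rfl

lemma norm_le_one {A : Herm n} (hA : A.mat.PosSemidef) (h1 : ⟪A, one⟫_ℝ = 1) : ‖A‖ ≤ 1 := by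
  have h0 := hA.eigenvalues_nonneg
  have hs := A.sum_eigenvalues
  rw [h1] at hs
  have : ‖A‖ ^ 2 ≤ 1 := by
    rw [norm_sq_eq_sum_eigenvalues, ← hs]
    refine Finset.sum_le_sum fun i _ => ?_
    have hi : A.isHermitian.eigenvalues i ≤ 1 := hs ▸
      Finset.single_le_sum (f := A.isHermitian.eigenvalues) (fun j _ => h0 j) (Finset.mem_univ i)
    rw [sq]
    exact mul_le_of_le_one_left (h0 i) hi
  exact (sq_le_one_iff₀ (norm_nonneg _)).mp this

/-- The eigenvalues lie in `[0, 1]` and sum to one. Norm one means that the nonnegative numbers `l i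
- l i ^ 2` sum to zero, so every eigenvalue is 0 or 1 and exactly one of them is 1. -/
lemma norm_eq_one_iff_rank_eq_one {A : Herm n} (hA : A.mat.PosSemidef) (h1 : ⟪A, one⟫_ℝ = 1) :
    ‖A‖ = 1 ↔ A.mat.rank = 1 := by
  have h0 := hA.eigenvalues_nonneg
  have hs := A.sum_eigenvalues
  rw [h1] at hs
  rw [← sq_eq_sq₀ (norm_nonneg _) zero_le_one, one_pow, norm_sq_eq_sum_eigenvalues,
    A.isHermitian.rank_eq_card_non_zero_eigs, Fintype.card_subtype]
  set l := A.isHermitian.eigenvalues with hl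
  constructor
  · intro h2
    have h3 : ∑ i, (l i - l i ^ 2) = 0 := by rw [Finset.sum_sub_distrib, hs, h2, sub_self]
    have hle (i : n) : l i ≤ 1 := hs ▸
      Finset.single_le_sum (f := l) (fun j _ => h0 j) (Finset.mem_univ i)
    rw [Finset.sum_eq_zero_iff_of_nonneg] at h3
    · have h4 (i : n) : l i = if l i ≠ 0 then 1 else 0 := by
        have h5 : l i * (1 - l i) = 0 := by
          have := h3 i (Finset.mem_univ _); linarith
        rcases mul_eq_zero.mp h5 with h6 | h6
        · simp [h6]
        · have : l i = 1 := by linarith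
          simp [this]
      rw [Finset.sum_congr rfl fun i _ => h4 i, Finset.sum_boole] at hs
      exact_mod_cast hs
    · intro i _
      have := mul_nonneg (h0 i) (sub_nonneg.mpr (hle i))
      change 0 ≤ l i - l i ^ 2
      linarith
  · intro h2
    obtain ⟨i, hi⟩ := Finset.card_eq_one.mp h2
    have h3 (j : n) (hj : j ≠ i) : l j = 0 := by
      by_contra h
      have : j ∈ Finset.univ.filter fun i => l i ≠ 0 := by simp [h]
      rw [hi, Finset.mem_singleton] at this
      exact hj this
    rw [Finset.sum_eq_single i (fun j _ hj => h3 j hj) (by simp)] at hs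
    rw [Finset.sum_eq_single i (fun j _ hj => by rw [h3 j hj]; simp) (by simp), hs, one_pow]

/-- The real quadratic form of a Hermitian operator at a vector, as a continuous linear functional
of the operator. -/
def quadForm (v : n → ℂ) : Herm n →L[ℝ] ℝ :=
  innerSL ℝ (ofMat (vecMulVec v (star v)) (by
    rw [Matrix.IsHermitian, conjTranspose_vecMulVec, star_star]))

omit [DecidableEq n] in
lemma quadForm_apply (v : n → ℂ) (A : Herm n) : quadForm v A = (star v ⬝ᵥ A.mat *ᵥ v).re := by
  change ⟪ofMat _ _, A⟫_ℝ = _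
  rw [real_inner_comm, inner_eq_trace_mul, mat_ofMat, mul_vecMulVec, trace_vecMulVec,
    dotProduct_comm]

omit [DecidableEq n] in
lemma posSemidef_iff_quadForm_nonneg (A : Herm n) :
    A.mat.PosSemidef ↔ ∀ v, 0 ≤ quadForm v A := by
  rw [Matrix.posSemidef_iff_dotProduct_mulVec, and_iff_right A.isHermitian]
  refine forall_congr' fun v => ?_
  rw [quadForm_apply, RCLike.nonneg_iff (K := ℂ)]
  exact and_iff_left (A.isHermitian.im_star_dotProduct_mulVec_self v)

end Herm

/-! ### The density of a positive-operator-valued measure -/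

namespace POVM

variable {X : Type*} [MeasurableSpace X] {n : Type*} [Fintype n] [DecidableEq n] (F : POVM X n)

lemma stronglyMeasurable_density : StronglyMeasurable F.density := by
  unfold density
  exact Finset.stronglyMeasurable_fun_sum (M := Herm n) Finset.univ fun k _ =>
    (SignedMeasure.measurable_rnDeriv _ _).stronglyMeasurable.smul_const
      (stdOrthonormalBasis ℝ (Herm n) k)

lemma setIntegral_apply_density (L : Herm n →L[ℝ] ℝ) {E : Set X} (hE : MeasurableSet E) :
    ∫ x in E, L (F.density x) ∂F.traceMeasure = L (F.toFun E) := by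
  rw [L.integral_comp_comm F.integrable_density.integrableOn, F.setIntegral_density hE]

lemma traceMeasure_real {E : Set X} (hE : MeasurableSet E) :
    F.traceMeasure.real E = ⟪F.toFun E, Herm.one⟫_ℝ := by
  rw [measureReal_def, traceMeasure, pairingMeasure_apply _ _ _ hE, ← Herm.inner_eq_trace_mul,
    ENNReal.toReal_ofReal]
  rw [Herm.inner_eq_trace_mul]
  exact (F.posSemidef E hE).re_trace_mul_nonneg Herm.posSemidef_one

lemma inner_density_one : ∀ᵐ x ∂F.traceMeasure, ⟪F.density x, Herm.one⟫_ℝ = 1 := by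
  refine Integrable.ae_eq_of_forall_setIntegral_eq _ (fun _ => (1 : ℝ))
    (F.integrable_density.inner_const _) (integrable_const _) fun E hE _ => ?_
  have h1 := F.setIntegral_apply_density (innerSL ℝ Herm.one) hE
  simp only [innerSL_apply_apply, real_inner_comm _ Herm.one] at h1
  rw [h1, ← F.traceMeasure_real hE]
  simp

/-- For a fixed vector, nonnegativity of the quadratic form follows from that of its integrals over
all events, off a null set depending on the vector. A countable dense set of vectors gives a common
null set, and continuity in the vector does the rest. -/
lemma posSemidef_density : ∀ᵐ x ∂F.traceMeasure, (F.density x).mat.PosSemidef := by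
  have h1 (v : n → ℂ) : ∀ᵐ x ∂F.traceMeasure, 0 ≤ Herm.quadForm v (F.density x) := by
    refine ae_nonneg_of_forall_setIntegral_nonneg
      ((Herm.quadForm v).integrable_comp F.integrable_density) fun E hE _ => ?_
    rw [F.setIntegral_apply_density _ hE]
    exact (Herm.posSemidef_iff_quadForm_nonneg _).mp (F.posSemidef E hE) v
  have h2 := ae_all_iff.mpr fun k => h1 (TopologicalSpace.denseSeq (n → ℂ) k)
  filter_upwards [h2] with x hx
  rw [Herm.posSemidef_iff_quadForm_nonneg]
  have hc : Continuous fun v : n → ℂ => Herm.quadForm v (F.density x) := by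
    simp only [Herm.quadForm_apply]
    fun_prop
  have hcl : IsClosed {v : n → ℂ | 0 ≤ Herm.quadForm v (F.density x)} :=
    isClosed_le continuous_const hc
  intro v
  have := hcl.closure_subset_iff.mpr (Set.range_subset_iff.mpr hx)
  rw [(TopologicalSpace.denseRange_denseSeq (n → ℂ)).closure_range] at this
  exact this (Set.mem_univ v)

lemma norm_density_le : ∀ᵐ x ∂F.traceMeasure, ‖F.density x‖ ≤ 1 := by
  filter_upwards [F.posSemidef_density, F.inner_density_one] with x h1 h2
  exact Herm.norm_le_one h1 h2

lemma normalizedFamily_density [Nonempty n] :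
    NormalizedFamily F.traceMeasure F.density (Herm.one : Herm n) where
  aestronglyMeasurable := F.stronglyMeasurable_density.aestronglyMeasurable
  norm_le := F.norm_density_le
  inner_eq := F.inner_density_one
  integral_eq := by
    rw [← setIntegral_univ, F.setIntegral_density MeasurableSet.univ, F.univ]
  ne_zero := by
    rw [ne_eq, ← inner_self_eq_zero (𝕜 := ℝ), Herm.inner_one_one]
    simp

lemma isRankOne_iff : F.IsRankOne ↔ ∀ᵐ x ∂F.traceMeasure, ‖F.density x‖ = 1 := by
  refine Filter.eventually_congr ?_
  filter_upwards [F.posSemidef_density, F.inner_density_one] with x h1 h2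
  exact (Herm.norm_eq_one_iff_rank_eq_one h1 h2).symm

lemma tracelessPart_density : ∀ᵐ x ∂F.traceMeasure, tracelessPart (F.density x) =
    F.density x - (1 / ⟪(Herm.one : Herm n), Herm.one⟫_ℝ) • Herm.one := by
  filter_upwards [F.inner_density_one] with x h1
  rw [tracelessPart, ← Herm.inner_one, h1, Herm.inner_one_one]

/-! ### Outcome distributions -/

variable (ρ : QState n)

lemma inner_density_state_nonneg : ∀ᵐ x ∂F.traceMeasure, 0 ≤ ⟪F.density x, ρ.op⟫_ℝ := by
  filter_upwards [F.posSemidef_density] with x hx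
  rw [Herm.inner_eq_trace_mul]
  exact hx.re_trace_mul_nonneg ρ.posSemidef

lemma measurable_inner_density (A : Herm n) : Measurable fun x => ⟪F.density x, A⟫_ℝ :=
  (F.stronglyMeasurable_density.inner stronglyMeasurable_const).measurable

lemma outcomeMeasure_eq_withDensity : F.outcomeMeasure ρ =
    F.traceMeasure.withDensity fun x => ENNReal.ofReal ⟪F.density x, ρ.op⟫_ℝ := by
  ext E hE
  rw [withDensity_apply _ hE, outcomeMeasure, pairingMeasure_apply _ _ _ hE,
    ← ofReal_integral_eq_lintegral_ofReal (F.integrable_density.inner_const _).integrableOn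
      (ae_restrict_of_ae (F.inner_density_state_nonneg ρ))]
  have h1 := F.setIntegral_apply_density (innerSL ℝ ρ.op) hE
  simp only [innerSL_apply_apply, real_inner_comm _ ρ.op] at h1
  rw [h1, Herm.inner_eq_trace_mul]

lemma outcomeMeasure_absolutelyContinuous : F.outcomeMeasure ρ ≪ F.traceMeasure := by
  rw [outcomeMeasure_eq_withDensity]
  exact withDensity_absolutelyContinuous _ _

instance : IsProbabilityMeasure (F.outcomeMeasure ρ) where
  measure_univ := by
    rw [outcomeMeasure, pairingMeasure_apply _ _ _ MeasurableSet.univ, F.univ]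
    simp [Herm.one, ρ.trace_eq_one]

lemma integral_outcomeMeasure (Q : X → Herm n) : ∫ x, Q x ∂F.outcomeMeasure ρ =
    ∫ x, ⟪F.density x, ρ.op⟫_ℝ • Q x ∂F.traceMeasure := by
  rw [outcomeMeasure_eq_withDensity, integral_withDensity_eq_integral_toReal_smul
    (F.measurable_inner_density ρ.op).ennreal_ofReal
    (Filter.Eventually.of_forall fun _ => ENNReal.ofReal_lt_top)]
  refine integral_congr_ae ?_
  filter_upwards [F.inner_density_state_nonneg ρ] with x hx
  rw [ENNReal.toReal_ofReal hx]

lemma lintegral_outcomeMeasure {f : X → ℝ≥0∞} (hf : AEMeasurable f F.traceMeasure) :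
    ∫⁻ x, f x ∂F.outcomeMeasure ρ =
      ∫⁻ x, ENNReal.ofReal ⟪F.density x, ρ.op⟫_ℝ * f x ∂F.traceMeasure := by
  rw [outcomeMeasure_eq_withDensity, lintegral_withDensity_eq_lintegral_mul₀
    (F.measurable_inner_density ρ.op).ennreal_ofReal.aemeasurable hf]
  rfl

end POVM

/-! ### The mean squared error of an empirical mean -/

section EmpiricalMean

open ProbabilityTheory

variable {X : Type*} [MeasurableSpace X] {p : Measure X} [IsProbabilityMeasure p]

/-- By Fubini almost every slice of the squared sum, with all outcomes but one held fixed, is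
integrable; on such a slice the sum is `f` plus a constant. This shows that a `Q` with infinite
second moment has infinite error for every `N`. -/
lemma memLp_two_of_memLp_two_sum {N : ℕ} (hN : 0 < N) {f : X → ℝ} (hf : AEStronglyMeasurable f p)
    (h : MemLp (fun y : Fin N → X => ∑ k, f (y k)) 2 (Measure.pi fun _ => p)) : MemLp f 2 p := by
  obtain ⟨M, rfl⟩ := Nat.exists_eq_succ_of_ne_zero hN.ne'
  have hmp := (measurePreserving_piFinSuccAbove (fun _ : Fin (M + 1) => p) 0).symm
  have h1 := (h.comp_measurePreserving hmp).integrable_sq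
  obtain ⟨z, hz⟩ := (h1.prod_left_ae).exists
  have h2 : MemLp (fun x => f x + ∑ k, f (z k)) 2 p := by
    rw [memLp_two_iff_integrable_sq (by exact hf.add aestronglyMeasurable_const)]
    refine hz.congr (Filter.Eventually.of_forall fun x => ?_)
    simp [Fin.sum_univ_succ, MeasurableEquiv.piFinSuccAbove]
  have h3 : MemLp (fun _ : X => ∑ k, f (z k)) 2 p := memLp_const _
  have h4 := h2.sub h3
  refine h4.ae_eq (Filter.Eventually.of_forall fun x => ?_)
  simp

lemma evariance_mean {N : ℕ} (hN : 0 < N) {f : X → ℝ} (hf : AEStronglyMeasurable f p) :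
    eVar[fun y : Fin N → X => (1 / N : ℝ) * ∑ k, f (y k); Measure.pi fun _ => p] =
      ENNReal.ofReal (1 / N) * eVar[f; p] := by
  have hN' : (0 : ℝ) < N := by exact_mod_cast hN
  have hmeas : AEStronglyMeasurable (fun y : Fin N → X => ∑ k, f (y k))
      (Measure.pi fun _ => p) :=
    Finset.aestronglyMeasurable_fun_sum _ fun k _ =>
      hf.comp_measurePreserving (measurePreserving_eval (fun _ : Fin N => p) k)
  rw [evariance_mul]
  by_cases hL : MemLp f 2 p
  · have hsum : MemLp (fun y : Fin N → X => ∑ k, f (y k)) 2 (Measure.pi fun _ => p) :=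
      memLp_finsetSum _ fun k _ =>
        hL.comp_measurePreserving (measurePreserving_eval (fun _ : Fin N => p) k)
    rw [← ofReal_variance hL, ← ofReal_variance hsum, ← ENNReal.ofReal_mul (by positivity),
      ← ENNReal.ofReal_mul (by positivity)]
    have h1 := variance_sum_pi (μ := fun _ : Fin N => p) (X := fun _ => f) fun _ => hL
    have h2 : (∑ k, fun y : Fin N → X => f (y k)) = fun y => ∑ k, f (y k) := by
      ext y; simp
    rw [h2] at h1
    rw [h1]
    congr 1
    simp only [Finset.sum_const, Finset.card_univ, Fintype.card_fin, nsmul_eq_mul]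
    field_simp
  · rw [evariance_eq_top hf hL,
      evariance_eq_top hmeas fun h => hL (memLp_two_of_memLp_two_sum hN hf h),
      ENNReal.mul_top (ENNReal.ofReal_pos.mpr (by positivity)).ne',
      ENNReal.mul_top (ENNReal.ofReal_pos.mpr (by positivity)).ne']

variable {E : Type*} [NormedAddCommGroup E] [InnerProductSpace ℝ E] [FiniteDimensional ℝ E]

/-- Splitting into coordinates reduces the vector-valued mean to real random variables. Extended
variances are used so that an infinite second moment needs no separate treatment here. -/
lemma lintegral_norm_sub_integral_sq {Ω : Type*} [MeasurableSpace Ω] {q : Measure Ω} {Z : Ω → E}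
    (hZ : Integrable Z q) : ∫⁻ ω, ENNReal.ofReal (‖∫ ω, Z ω ∂q - Z ω‖ ^ 2) ∂q =
      ∑ k, eVar[fun ω => ⟪stdOrthonormalBasis ℝ E k, Z ω⟫_ℝ; q] := by
  simp only [evariance_eq_lintegral_ofReal]
  rw [← lintegral_finsetSum']
  · refine lintegral_congr fun ω => ?_
    rw [← ENNReal.ofReal_sum_of_nonneg fun _ _ => sq_nonneg _, ← norm_neg, neg_sub,
      ← (stdOrthonormalBasis ℝ E).sum_sq_norm_inner_right]
    congr 1
    refine Finset.sum_congr rfl fun k _ => ?_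
    rw [inner_sub_right, integral_inner hZ, Real.norm_eq_abs, sq_abs]
  · intro k _
    exact (((hZ.const_inner (stdOrthonormalBasis ℝ E k)).aestronglyMeasurable.aemeasurable.sub_const
      _).pow_const 2).ennreal_ofReal

lemma lintegral_norm_sub_mean_sq {N : ℕ} (hN : 0 < N) {Q : X → E} (hQ : Integrable Q p) :
    ∫⁻ y, ENNReal.ofReal (‖∫ x, Q x ∂p - (1 / N : ℝ) • ∑ k, Q (y k)‖ ^ 2)
      ∂(Measure.pi fun _ : Fin N => p) =
      ENNReal.ofReal (1 / N) * ∫⁻ x, ENNReal.ofReal (‖∫ x, Q x ∂p - Q x‖ ^ 2) ∂p := by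
  have hN' : (N : ℝ) ≠ 0 := by exact_mod_cast hN.ne'
  have hk (k : Fin N) : Integrable (fun y : Fin N → X => Q (y k)) (Measure.pi fun _ => p) :=
    integrable_comp_eval (μ := fun _ : Fin N => p) hQ
  have hZ : Integrable (fun y : Fin N → X => (1 / N : ℝ) • ∑ k, Q (y k)) (Measure.pi fun _ => p) :=
    (integrable_finsetSum _ fun k _ => hk k).smul (1 / N : ℝ)
  have hmean : ∫ y, (1 / N : ℝ) • ∑ k, Q (y k) ∂(Measure.pi fun _ : Fin N => p) =
      ∫ x, Q x ∂p := by
    rw [integral_smul, integral_finsetSum _ fun k _ => hk k]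
    have (k : Fin N) : ∫ y, Q (y k) ∂(Measure.pi fun _ : Fin N => p) = ∫ x, Q x ∂p :=
      integral_comp_eval (μ := fun _ : Fin N => p) hQ.aestronglyMeasurable
    simp only [this, Finset.sum_const, Finset.card_univ, Fintype.card_fin]
    rw [← Nat.cast_smul_eq_nsmul ℝ, smul_smul, one_div_mul_cancel hN', one_smul]
  have h1 := lintegral_norm_sub_integral_sq hZ
  rw [hmean] at h1
  rw [h1, lintegral_norm_sub_integral_sq hQ, Finset.mul_sum]
  refine Finset.sum_congr rfl fun k _ => ?_
  rw [← evariance_mean hN (hQ.const_inner _).aestronglyMeasurable]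
  congr 1
  ext y
  rw [inner_smul_right, inner_sum]

lemma lintegral_norm_sub_integral_sq_add {Q : X → E} (hQ : Integrable Q p) :
    ∫⁻ x, ENNReal.ofReal (‖∫ x, Q x ∂p - Q x‖ ^ 2) ∂p + ENNReal.ofReal (‖∫ x, Q x ∂p‖ ^ 2) =
      ∫⁻ x, ENNReal.ofReal (‖Q x‖ ^ 2) ∂p := by
  set m := ∫ x, Q x ∂p with hm
  have hconst : MemLp (fun _ : X => m) 2 p := memLp_const _
  by_cases hL : MemLp Q 2 p
  · have hL' : MemLp (fun x => m - Q x) 2 p := hconst.sub hL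
    rw [lintegral_ofReal_norm_sq_eq hL, lintegral_ofReal_norm_sq_eq hL',
      ← ENNReal.ofReal_add (integral_nonneg fun _ => sq_nonneg _) (sq_nonneg _)]
    congr 1
    have h1 : ∀ x, ‖m - Q x‖ ^ 2 = ‖m‖ ^ 2 - 2 * ⟪m, Q x⟫_ℝ + ‖Q x‖ ^ 2 := fun x =>
      norm_sub_sq_real _ _
    have h2 : Integrable (fun x => 2 * ⟪m, Q x⟫_ℝ) p := (hQ.const_inner m).const_mul 2
    simp only [h1]
    rw [integral_add (by exact (integrable_const _).sub h2) hL.norm.integrable_sq,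
      integral_sub (integrable_const _) h2, integral_const_mul, integral_inner hQ, ← hm,
      real_inner_self_eq_norm_sq]
    simp
    ring
  · have h1 : ∫⁻ x, ENNReal.ofReal (‖Q x‖ ^ 2) ∂p = ∞ := by
      by_contra h
      exact hL (memLp_two_of_lintegral_ne_top hQ.aestronglyMeasurable h)
    have h2 : ∫⁻ x, ENNReal.ofReal (‖m - Q x‖ ^ 2) ∂p = ∞ := by
      by_contra h
      have h3 : MemLp (fun x => m - Q x) 2 p := memLp_two_of_lintegral_ne_top
        (aestronglyMeasurable_const.sub hQ.aestronglyMeasurable) h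
      have h4 := hconst.sub h3
      exact hL (h4.ae_eq (Filter.Eventually.of_forall fun x => by simp))
    rw [h1, h2, top_add]

end EmpiricalMean

/-- The expected error of the linear estimate, in terms of the second moment of `Q`. -/
lemma expectedError_add {X : Type*} [MeasurableSpace X] {n : Type*} [Fintype n] [DecidableEq n]
    {F : POVM X n} {S : Set (QState n)} {Q : X → Herm n} (hQ : F.IsReconstruction S Q) {N : ℕ}
    (hN : 0 < N) {ρ : QState n} (hρ : ρ ∈ S) :
    expectedError F Q N ρ + ENNReal.ofReal (‖ρ.op‖ ^ 2 / N) =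
      ENNReal.ofReal (1 / N) * ∫⁻ x, ENNReal.ofReal (‖Q x‖ ^ 2) ∂F.outcomeMeasure ρ := by
  have hint := hQ.integrable ρ hρ
  rw [← lintegral_norm_sub_integral_sq_add hint, mul_add, ← lintegral_norm_sub_mean_sq hN hint,
    ← hQ.reconstruct ρ hρ, ← ENNReal.ofReal_mul (by positivity), one_div_mul_eq_div]
  rfl

/-! ### Averages over the unitary group -/

section Haar

variable {d : ℕ}

instance : (unitaryHaar d).IsMulLeftInvariant := by unfold unitaryHaar; infer_instance

instance : IsProbabilityMeasure (unitaryHaar d) := ⟨by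
  unfold unitaryHaar
  exact Measure.haarMeasure_self⟩

lemma continuous_unitary_entry (i j : Fin d) :
    Continuous fun U : unitaryGroup (Fin d) ℂ => U.1 i j :=
  (continuous_apply j).comp ((continuous_apply i).comp continuous_subtype_val)

lemma integrable_unitary {f : unitaryGroup (Fin d) ℂ → ℂ} (hf : Continuous f) :
    Integrable f (unitaryHaar d) :=
  hf.integrable_of_hasCompactSupport (HasCompactSupport.of_compactSpace f)

lemma integral_unitary_mul_left (f : unitaryGroup (Fin d) ℂ → ℂ) (V : unitaryGroup (Fin d) ℂ) :
    ∫ U, f (V * U) ∂unitaryHaar d = ∫ U, f U ∂unitaryHaar d :=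
  integral_mul_left_eq_self f V

lemma sum_unitary_entries (U : unitaryGroup (Fin d) ℂ) (k l : Fin d) :
    ∑ i, U.1 i l * star (U.1 i k) = if l = k then 1 else 0 := by
  have h := congrFun (congrFun (Matrix.UnitaryGroup.star_mul_self U) k) l
  rw [Matrix.mul_apply, Matrix.one_apply] at h
  simp only [Matrix.star_apply] at h
  simp only [mul_comm (U.1 _ l), h, eq_comm]

/-- The diagonal unitary with a sign at `i`. -/
def signUnitary (i : Fin d) : unitaryGroup (Fin d) ℂ :=
  ⟨diagonal fun j => if j = i then -1 else 1, by
    rw [mem_unitaryGroup_iff, star_eq_conjTranspose, diagonal_conjTranspose, diagonal_mul_diagonal,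
      ← diagonal_one]
    congr 1
    ext j
    by_cases h : j = i <;> simp [h]⟩

/-- The permutation unitary of a transposition. -/
def swapUnitary (i k : Fin d) : unitaryGroup (Fin d) ℂ :=
  ⟨(Equiv.swap i k).toPEquiv.toMatrix, by
    rw [mem_unitaryGroup_iff, star_eq_conjTranspose]
    ext a b
    simp only [PEquiv.toMatrix_toPEquiv_mul]
    simp [PEquiv.toMatrix_apply, Matrix.one_apply]⟩

/-- Haar invariance under a sign flip of row `i` kills the integral when `i ≠ k`. When `i = k`,
invariance under transpositions makes it independent of the row, and the sum over the `d` rows is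
known from the orthonormality of the columns. -/
lemma integral_unitary_entries (i j k l : Fin d) :
    ∫ U : unitaryGroup (Fin d) ℂ, U.1 i j * star (U.1 k l) ∂unitaryHaar d =
      if i = k ∧ j = l then (1 / d : ℂ) else 0 := by
  have hint (i j k l : Fin d) : Integrable
      (fun U : unitaryGroup (Fin d) ℂ => U.1 i j * star (U.1 k l)) (unitaryHaar d) :=
    integrable_unitary
      ((continuous_unitary_entry i j).mul (continuous_star.comp (continuous_unitary_entry k l)))
  by_cases hik : i = k
  · subst hik
    have hswap (i' : Fin d) :
        ∫ U : unitaryGroup (Fin d) ℂ, U.1 i' j * star (U.1 i' l) ∂unitaryHaar d =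
          ∫ U : unitaryGroup (Fin d) ℂ, U.1 i j * star (U.1 i l) ∂unitaryHaar d := by
      rw [← integral_unitary_mul_left _ (swapUnitary i' i)]
      refine integral_congr_ae (Filter.Eventually.of_forall fun U => ?_)
      simp [swapUnitary, PEquiv.toMatrix_toPEquiv_mul]
    have hsum : ∑ i', ∫ U : unitaryGroup (Fin d) ℂ, U.1 i' j * star (U.1 i' l) ∂unitaryHaar d =
        if j = l then 1 else 0 := by
      rw [← integral_finsetSum _ fun i' _ => hint i' j i' l]
      simp only [sum_unitary_entries]
      simp
    simp only [hswap, Finset.sum_const, Finset.card_univ, Fintype.card_fin, nsmul_eq_mul] at hsum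
    have hd : (d : ℂ) ≠ 0 := by exact_mod_cast (Fin.pos i).ne'
    rw [eq_div_of_mul_eq hd ((mul_comm _ _).trans hsum)]
    by_cases hjl : j = l <;> simp [hjl]
  · have h1 := integral_unitary_mul_left
      (fun U : unitaryGroup (Fin d) ℂ => U.1 i j * star (U.1 k l)) (signUnitary i)
    have h2 (U : unitaryGroup (Fin d) ℂ) :
        (signUnitary i * U).1 i j * star ((signUnitary i * U).1 k l) =
          -(U.1 i j * star (U.1 k l)) := by
      simp [signUnitary, Matrix.diagonal_mul, Ne.symm hik]
    simp only [h2, integral_neg] at h1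
    rw [if_neg fun h => hik h.1]
    exact self_eq_neg.mp h1.symm

lemma localUnitary_conj_apply (A : Matrix (Fin d × Fin d) (Fin d × Fin d) ℂ)
    (U V : unitaryGroup (Fin d) ℂ) (i j : Fin d × Fin d) :
    ((localUnitary U V).1 * A * (localUnitary U V).1ᴴ) i j =
      ∑ k, ∑ l, (A l k * (U.1 i.1 l.1 * star (U.1 j.1 k.1))) * (V.1 i.2 l.2 * star (V.1 j.2 k.2)) := by
  simp only [Matrix.mul_apply, Finset.sum_mul, Matrix.conjTranspose_apply, localUnitary,
    Matrix.kroneckerMap_apply, star_mul']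
  refine Finset.sum_congr rfl fun k _ => Finset.sum_congr rfl fun l _ => ?_
  ring

/-- Twirling over local unitaries depolarizes completely. -/
lemma integral_localUnitary_conj (A : Matrix (Fin d × Fin d) (Fin d × Fin d) ℂ)
    (i j : Fin d × Fin d) :
    ∫ U, ∫ V, ((localUnitary U V).1 * A * (localUnitary U V).1ᴴ) i j ∂unitaryHaar d ∂unitaryHaar d =
      if i = j then A.trace / d ^ 2 else 0 := by
  have hint (i j k l : Fin d) : Integrable
      (fun U : unitaryGroup (Fin d) ℂ => U.1 i j * star (U.1 k l)) (unitaryHaar d) :=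
    integrable_unitary
      ((continuous_unitary_entry i j).mul (continuous_star.comp (continuous_unitary_entry k l)))
  simp only [localUnitary_conj_apply]
  have h1 (U : unitaryGroup (Fin d) ℂ) : ∫ V : unitaryGroup (Fin d) ℂ, ∑ k, ∑ l,
      (A l k * (U.1 i.1 l.1 * star (U.1 j.1 k.1))) * (V.1 i.2 l.2 * star (V.1 j.2 k.2))
        ∂unitaryHaar d = ∑ k, ∑ l, (U.1 i.1 l.1 * star (U.1 j.1 k.1)) *
          (A l k * if i.2 = j.2 ∧ l.2 = k.2 then (1 / d : ℂ) else 0) := by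
    rw [integral_finsetSum _ fun k _ => integrable_finsetSum _ fun l _ => (hint _ _ _ _).const_mul _]
    refine Finset.sum_congr rfl fun k _ => ?_
    rw [integral_finsetSum _ fun l _ => (hint _ _ _ _).const_mul _]
    refine Finset.sum_congr rfl fun l _ => ?_
    rw [integral_const_mul, integral_unitary_entries]
    ring
  simp only [h1]
  rw [integral_finsetSum _ fun k _ => integrable_finsetSum _ fun l _ => (hint _ _ _ _).mul_const _]
  have h2 (k : Fin d × Fin d) : ∫ U : unitaryGroup (Fin d) ℂ, ∑ l,
      (U.1 i.1 l.1 * star (U.1 j.1 k.1)) *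
          (A l k * if i.2 = j.2 ∧ l.2 = k.2 then (1 / d : ℂ) else 0) ∂unitaryHaar d =
      if i = j then A k k / d ^ 2 else 0 := by
    rw [integral_finsetSum _ fun l _ => (hint _ _ _ _).mul_const _]
    simp only [integral_mul_const, integral_unitary_entries]
    rw [Finset.sum_eq_single k]
    · by_cases hij : i = j
      · subst hij
        simp
        ring
      · rw [if_neg hij]
        rw [Prod.ext_iff, not_and_or] at hij
        rcases hij with h | h <;> simp [h]
    · intro l _ hl
      rw [ne_eq, Prod.ext_iff, not_and_or] at hl
      rcases hl with h | h <;> simp [h]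
    · simp
  simp only [h2]
  by_cases hij : i = j
  · simp only [hij, if_true, Matrix.trace, Matrix.diag, Finset.sum_div]
  · simp [hij]

end Haar

/-! ### Dimensions of spaces of Hermitian operators -/

namespace Herm

/-- Real and imaginary parts identify the real space of complex matrices with two copies of the
Hermitian operators, so the dimension is half of `2 * n ^ 2`. -/
lemma finrank_eq {n : Type*} [Fintype n] :
    Module.finrank ℝ (Herm n) = Fintype.card n ^ 2 := by
  classical
  let f : Matrix n n ℂ →ₗ[ℝ] selfAdjoint (Matrix n n ℂ) × selfAdjoint (Matrix n n ℂ) :=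
    realPart.prod imaginaryPart
  have hf : Function.Bijective f := by
    constructor
    · intro A B hAB
      have h1 : realPart A = realPart B := congrArg Prod.fst hAB
      have h2 : imaginaryPart A = imaginaryPart B := congrArg Prod.snd hAB
      rw [← realPart_add_I_smul_imaginaryPart A, ← realPart_add_I_smul_imaginaryPart B, h1, h2]
    · rintro ⟨A, B⟩
      refine ⟨(A : Matrix n n ℂ) + Complex.I • (B : Matrix n n ℂ), ?_⟩
      refine Prod.ext ?_ ?_
      · change realPart _ = A
        rw [map_add, realPart_I_smul, B.2.imaginaryPart, selfAdjoint.realPart_coe, neg_zero,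
          add_zero]
      · change imaginaryPart _ = B
        rw [map_add, imaginaryPart_I_smul, A.2.imaginaryPart, selfAdjoint.realPart_coe, zero_add]
  have h1 := (LinearEquiv.ofBijective f hf).finrank_eq
  have h2 : Module.finrank ℝ (Matrix n n ℂ) = 2 * Fintype.card n ^ 2 := by
    rw [Module.finrank_matrix, Complex.finrank_real_complex]; ring
  have : Module.Finite ℝ (selfAdjoint (Matrix n n ℂ)) :=
    inferInstanceAs (Module.Finite ℝ (Herm n))
  rw [Module.finrank_prod, h2] at h1
  have h3 : Module.finrank ℝ (Herm n) = Module.finrank ℝ (selfAdjoint (Matrix n n ℂ)) := rfl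
  omega

variable {n : Type*} [Fintype n] [DecidableEq n]

/-- The shift `t = ‖A‖` suffices: the quadratic form at `v` is the pairing with the positive
operator `w = v v†`, Cauchy–Schwarz bounds it below by `-‖w‖ * ‖A‖`, and `‖w‖ ≤ tr w` because the
eigenvalues of `w` are nonnegative. -/
lemma exists_posSemidef_add_smul_one (A : Herm n) :
    ∃ t : ℝ, (A + t • (one : Herm n)).mat.PosSemidef := by
  refine ⟨‖A‖, (posSemidef_iff_quadForm_nonneg _).mpr fun v => ?_⟩
  rw [map_add, map_smul, smul_eq_mul]
  set w : Herm n := ofMat (vecMulVec v (star v)) (by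
    rw [Matrix.IsHermitian, conjTranspose_vecMulVec, star_star])
  have h1 : quadForm v A = ⟪w, A⟫_ℝ := rfl
  have h2 : quadForm v one = ⟪w, one⟫_ℝ := rfl
  have h3 : ‖w‖ ≤ ⟪w, one⟫_ℝ := by
    have hw : w.mat.PosSemidef := Matrix.posSemidef_vecMulVec_self_star v
    rw [← sq_le_sq₀ (norm_nonneg _) (by
      rw [inner_one]; exact (Complex.le_def.mp hw.trace_nonneg).1), norm_sq_eq_sum_eigenvalues,
      ← sum_eigenvalues]
    exact Finset.sum_sq_le_sq_sum_of_nonneg fun i _ => hw.eigenvalues_nonneg i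
  have h4 := (abs_le.mp (abs_real_inner_le_norm w A)).1
  rw [h1, h2]
  have h5 := mul_le_mul_of_nonneg_left h3 (norm_nonneg A)
  linarith

/-- The space of traceless Hermitian operators. -/
def traceless (n : Type*) [Fintype n] [DecidableEq n] : Submodule ℝ (Herm n) :=
  (Submodule.span ℝ {(one : Herm n)})ᗮ

lemma mem_traceless {A : Herm n} : A ∈ traceless n ↔ ⟪A, one⟫_ℝ = 0 := by
  rw [traceless, Submodule.mem_orthogonal_singleton_iff_inner_left]

lemma one_ne_zero [Nonempty n] : (one : Herm n) ≠ 0 := by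
  rw [ne_eq, ← inner_self_eq_zero (𝕜 := ℝ), inner_one_one]
  simp

lemma finrank_traceless [Nonempty n] :
    Module.finrank ℝ (traceless n) + 1 = Fintype.card n ^ 2 := by
  rw [← finrank_eq, ← Submodule.finrank_add_finrank_orthogonal (Submodule.span ℝ {(one : Herm n)}),
    finrank_span_singleton one_ne_zero, add_comm]
  rfl

/-- The projection to the traceless part, as a linear map. -/
def tracelessMap (n : Type*) [Fintype n] [DecidableEq n] : Herm n →ₗ[ℝ] Herm n where
  toFun A := A - (⟪A, one⟫_ℝ / Fintype.card n) • one
  map_add' A B := by rw [inner_add_left]; module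
  map_smul' r A := by
    rw [inner_smul_left, conj_trivial, RingHom.id_apply]; module

lemma tracelessMap_apply (A : Herm n) :
    tracelessMap n A = A - (⟪A, one⟫_ℝ / Fintype.card n) • one := rfl

lemma tracelessMap_mem [Nonempty n] (A : Herm n) : tracelessMap n A ∈ traceless n := by
  rw [mem_traceless, tracelessMap_apply, inner_sub_left, inner_smul_left, inner_one_one,
    conj_trivial, div_mul_cancel₀ _ (by simp), sub_self]

lemma tracelessMap_eq_self {A : Herm n} (hA : A ∈ traceless n) : tracelessMap n A = A := by
  rw [tracelessMap_apply, mem_traceless.mp hA, zero_div, zero_smul, sub_zero]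

/-! ### Partial traces of Hermitian operators -/

variable {m : Type*} [Fintype m] [DecidableEq m]

/-- The partial trace over the first factor. -/
def ptraceFst (m n : Type*) [Fintype m] : Herm (m × n) →ₗ[ℝ] Herm n where
  toFun A := ofMat (traceFst A.mat) (by
    ext i j
    simp only [conjTranspose_apply, traceFst, of_apply, star_sum]
    exact Finset.sum_congr rfl fun k _ => A.isHermitian.apply _ _)
  map_add' A B := by
    ext i j; simp [traceFst, Finset.sum_add_distrib]
  map_smul' r A := by
    ext i j; simp [traceFst, Finset.mul_sum]

/-- The partial trace over the second factor. -/
def ptraceSnd (m n : Type*) [Fintype n] : Herm (m × n) →ₗ[ℝ] Herm m where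
  toFun A := ofMat (traceSnd A.mat) (by
    ext i j
    simp only [conjTranspose_apply, traceSnd, of_apply, star_sum]
    exact Finset.sum_congr rfl fun k _ => A.isHermitian.apply _ _)
  map_add' A B := by
    ext i j; simp [traceSnd, Finset.sum_add_distrib]
  map_smul' r A := by
    ext i j; simp [traceSnd, Finset.mul_sum]

omit [DecidableEq n] [DecidableEq m] [Fintype n] in
lemma mat_ptraceFst (A : Herm (m × n)) : (ptraceFst m n A).mat = traceFst A.mat := rfl

omit [DecidableEq n] [DecidableEq m] [Fintype m] in
lemma mat_ptraceSnd (A : Herm (m × n)) : (ptraceSnd m n A).mat = traceSnd A.mat := rfl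

lemma inner_ptraceFst_one (A : Herm (m × n)) : ⟪ptraceFst m n A, one⟫_ℝ = ⟪A, one⟫_ℝ := by
  rw [inner_one, inner_one, mat_ptraceFst]
  congr 1
  simp only [Matrix.trace, Matrix.diag, traceFst, of_apply, Fintype.sum_prod_type]
  exact Finset.sum_comm

lemma inner_ptraceSnd_one (A : Herm (m × n)) : ⟪ptraceSnd m n A, one⟫_ℝ = ⟪A, one⟫_ℝ := by
  rw [inner_one, inner_one, mat_ptraceSnd]
  congr 1
  simp only [Matrix.trace, Matrix.diag, traceSnd, of_apply, Fintype.sum_prod_type]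

/-- The tensor product of Hermitian operators. -/
def kron (A : Herm m) (B : Herm n) : Herm (m × n) :=
  ofMat (A.mat ⊗ₖ B.mat) (by
    rw [Matrix.IsHermitian, conjTranspose_kronecker, A.isHermitian.eq, B.isHermitian.eq])

omit [Fintype n] [DecidableEq n] in
lemma ptraceFst_kron (A : Herm m) (B : Herm n) :
    ptraceFst m n (kron A B) = ⟪A, one⟫_ℝ • B := by
  ext i j
  rw [mat_ptraceFst, mat_smul, Matrix.smul_apply, Complex.real_smul, ← trace_eq_inner_one]
  simp [kron, traceFst, Matrix.trace, Finset.sum_mul]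

omit [Fintype m] [DecidableEq m] in
lemma ptraceSnd_kron (A : Herm m) (B : Herm n) :
    ptraceSnd m n (kron A B) = ⟪B, one⟫_ℝ • A := by
  ext i j
  rw [mat_ptraceSnd, mat_smul, Matrix.smul_apply, Complex.real_smul, ← trace_eq_inner_one]
  simp [kron, traceSnd, Matrix.trace, Finset.mul_sum, mul_comm]

omit [Fintype n] in
lemma ptraceFst_one : ptraceFst m n one = (Fintype.card m : ℝ) • one := by
  rw [← inner_one_one, ← ptraceFst_kron]
  congr 1
  ext1
  exact (Matrix.one_kronecker_one (m := m) (n := n)).symm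

omit [Fintype m] in
lemma ptraceSnd_one : ptraceSnd m n one = (Fintype.card n : ℝ) • one := by
  rw [← inner_one_one, ← ptraceSnd_kron]
  congr 1
  ext1
  exact (Matrix.one_kronecker_one (m := m) (n := n)).symm

lemma tracelessMap_one [Nonempty n] : tracelessMap n one = 0 := by
  rw [tracelessMap_apply, inner_one_one, div_self (by simp), one_smul, sub_self]

/-- The traceless part of the reduced operator on the second factor. -/
def reducedFst (m n : Type*) [Fintype m] [Fintype n] [DecidableEq n] :
    Herm (m × n) →ₗ[ℝ] Herm n := tracelessMap n ∘ₗ ptraceFst m n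

/-- The traceless part of the reduced operator on the first factor. -/
def reducedSnd (m n : Type*) [Fintype m] [Fintype n] [DecidableEq m] :
    Herm (m × n) →ₗ[ℝ] Herm m := tracelessMap m ∘ₗ ptraceSnd m n

variable [Nonempty m] [Nonempty n]

lemma range_reducedFst : LinearMap.range (reducedFst m n) = traceless n := by
  apply le_antisymm
  · rintro _ ⟨A, rfl⟩
    exact tracelessMap_mem _
  · intro B hB
    refine ⟨(Fintype.card m : ℝ)⁻¹ • kron one B, ?_⟩
    rw [map_smul, reducedFst, LinearMap.comp_apply, ptraceFst_kron, inner_one_one, map_smul,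
      tracelessMap_eq_self hB, smul_smul, inv_mul_cancel₀ (by simp), one_smul]

/-- The preimages `1 ⊗ B` and `C ⊗ 1`, suitably scaled, do not interfere, since tracing out a
traceless factor gives zero. The two marginal constraints are therefore independent and their
codimensions add. -/
lemma range_reducedFst_prod_reducedSnd :
    LinearMap.range ((reducedFst m n).prod (reducedSnd m n)) =
      (traceless n).prod (traceless m) := by
  apply le_antisymm
  · rintro _ ⟨A, rfl⟩
    exact ⟨tracelessMap_mem _, tracelessMap_mem _⟩
  · rintro ⟨B, C⟩ ⟨hB, hC⟩
    refine ⟨(Fintype.card m : ℝ)⁻¹ • kron one B + (Fintype.card n : ℝ)⁻¹ • kron C one, ?_⟩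
    have hB' := mem_traceless.mp hB
    have hC' := mem_traceless.mp hC
    refine Prod.ext ?_ ?_
    · change reducedFst m n _ = B
      simp only [map_add, map_smul, reducedFst, LinearMap.comp_apply, ptraceFst_kron, inner_one_one,
        tracelessMap_eq_self hB, hC', zero_smul, map_zero, smul_zero, add_zero]
      rw [smul_smul, inv_mul_cancel₀ (by simp), one_smul]
    · change reducedSnd m n _ = C
      simp only [map_add, map_smul, reducedSnd, LinearMap.comp_apply, ptraceSnd_kron, inner_one_one,
        tracelessMap_eq_self hC, hB', zero_smul, map_zero, smul_zero, zero_add]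
      rw [smul_smul, inv_mul_cancel₀ (by simp), one_smul]

lemma finrank_ker_reducedFst :
    Module.finrank ℝ (LinearMap.ker (reducedFst m n)) + Fintype.card n ^ 2 =
      (Fintype.card m * Fintype.card n) ^ 2 + 1 := by
  have h1 := LinearMap.finrank_range_add_finrank_ker (reducedFst m n)
  rw [range_reducedFst, finrank_eq, Fintype.card_prod] at h1
  have h2 := finrank_traceless (n := n)
  omega

lemma finrank_ker_reducedFst_prod_reducedSnd :
    Module.finrank ℝ (LinearMap.ker ((reducedFst m n).prod (reducedSnd m n))) +
      Fintype.card n ^ 2 + Fintype.card m ^ 2 = (Fintype.card m * Fintype.card n) ^ 2 + 2 := by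
  let e : (traceless n).prod (traceless m) ≃ₗ[ℝ] traceless n × traceless m :=
    { toFun := fun x => (⟨x.1.1, x.2.1⟩, ⟨x.1.2, x.2.2⟩)
      invFun := fun y => ⟨(y.1, y.2), y.1.2, y.2.2⟩
      map_add' := fun _ _ => rfl
      map_smul' := fun _ _ => rfl }
  have h1 := LinearMap.finrank_range_add_finrank_ker ((reducedFst m n).prod (reducedSnd m n))
  rw [range_reducedFst_prod_reducedSnd, finrank_eq, Fintype.card_prod,
    e.finrank_eq, Module.finrank_prod] at h1
  have h2 := finrank_traceless (n := n)
  have h3 := finrank_traceless (n := m)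
  omega

end Herm

/-! ### Spans of sets of states -/

namespace QState

variable {n : Type*} [Fintype n] [DecidableEq n]

lemma inner_op_one (ρ : QState n) : ⟪ρ.op, Herm.one⟫_ℝ = 1 := by
  rw [Herm.inner_one, ρ.trace_eq_one, Complex.one_re]

omit [DecidableEq n] in
lemma purity_eq (ρ : QState n) : ρ.purity = ‖ρ.op‖ ^ 2 := by
  rw [purity, ← real_inner_self_eq_norm_sq, Herm.inner_eq_trace_mul]

lemma purity_le_one (ρ : QState n) : ρ.purity ≤ 1 := by
  rw [purity_eq]
  exact pow_le_one₀ (norm_nonneg _) (Herm.norm_le_one ρ.posSemidef ρ.inner_op_one)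

lemma purity_rotate (ρ : QState n) (U : unitaryGroup n ℂ) : (ρ.rotate U).purity = ρ.purity := by
  have hU : star U.1 * U.1 = 1 := Matrix.UnitaryGroup.star_mul_self U
  have h1 : (ρ.rotate U).op.mat * (ρ.rotate U).op.mat = U.1 * (ρ.op.mat * ρ.op.mat) * star U.1 := by
    change U.1 * ρ.op.mat * star U.1 * (U.1 * ρ.op.mat * star U.1) = _
    calc _ = U.1 * ρ.op.mat * (star U.1 * U.1) * ρ.op.mat * star U.1 := by
          simp only [Matrix.mul_assoc]
      _ = _ := by rw [hU, Matrix.mul_one]; simp only [Matrix.mul_assoc]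
  rw [purity, h1, Matrix.trace_mul_cycle, hU, Matrix.one_mul, purity]

/-- A nonzero positive semidefinite operator, normalized to a state. -/
def normalize (A : Herm n) (hA : A.mat.PosSemidef) (h0 : 0 < ⟪A, Herm.one⟫_ℝ) : QState n where
  op := (⟪A, Herm.one⟫_ℝ)⁻¹ • A
  posSemidef := by
    rw [Herm.mat_smul]
    exact hA.smul (inv_nonneg.mpr h0.le)
  trace_eq_one := by
    rw [Herm.mat_smul, Matrix.trace_smul, Herm.trace_eq_inner_one, Complex.real_smul,
      ← Complex.ofReal_mul, inv_mul_cancel₀ h0.ne', Complex.ofReal_one]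

variable [Nonempty n]

/-- The maximally mixed state. -/
def maximallyMixed (n : Type*) [Fintype n] [DecidableEq n] [Nonempty n] : QState n :=
  normalize Herm.one Herm.posSemidef_one (real_inner_self_pos.mpr Herm.one_ne_zero)

/-- A subspace containing the identity is spanned by its positive elements, because each of its
members becomes positive after adding a multiple of the identity without leaving the subspace. -/
lemma span_setOf_op_mem {W : Submodule ℝ (Herm n)} (hW : Herm.one ∈ W) :
    span {ρ : QState n | ρ.op ∈ W} = W := by
  apply le_antisymm
  · rw [span, Submodule.span_le]
    rintro _ ⟨ρ, hρ, rfl⟩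
    exact hρ
  · have hpos (A : Herm n) (hA : A ∈ W) (hA0 : A.mat.PosSemidef) (h0 : 0 < ⟪A, Herm.one⟫_ℝ) :
        A ∈ span {ρ : QState n | ρ.op ∈ W} := by
      have h1 : A = ⟪A, Herm.one⟫_ℝ • (normalize A hA0 h0).op := by
        change A = ⟪A, Herm.one⟫_ℝ • ((⟪A, Herm.one⟫_ℝ)⁻¹ • A)
        rw [smul_smul, mul_inv_cancel₀ h0.ne', one_smul]
      rw [h1]
      exact Submodule.smul_mem _ _ (Submodule.subset_span
        ⟨normalize A hA0 h0, W.smul_mem _ hA, rfl⟩)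
    have h11 : 0 < ⟪(Herm.one : Herm n), Herm.one⟫_ℝ := real_inner_self_pos.mpr Herm.one_ne_zero
    have hone := hpos Herm.one hW Herm.posSemidef_one h11
    intro A hA
    obtain ⟨t, ht⟩ := A.exists_posSemidef_add_smul_one
    -- The additional `Herm.one` makes the trace strictly positive, so that the operator can be
    -- normalized to a state.
    have h2 : A = (A + t • Herm.one + Herm.one) - (t + 1) • Herm.one := by module
    rw [h2]
    refine Submodule.sub_mem _ (hpos _ (W.add_mem (W.add_mem hA (W.smul_mem _ hW)) hW)
      (ht.add Herm.posSemidef_one) ?_) (Submodule.smul_mem _ _ hone)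
    rw [inner_add_left]
    refine add_pos_of_nonneg_of_pos ?_ h11
    rw [Herm.inner_one]
    exact (Complex.le_def.mp ht.trace_nonneg).1

end QState

/-! ### Output states of channels: linear description and invariance under local unitaries -/

section Channels

variable {d : ℕ}

lemma Herm.tracelessMap_eq_zero_iff {n : Type*} [Fintype n] [DecidableEq n] {A : Herm n}
    (hA : ⟪A, Herm.one⟫_ℝ = 1) :
    Herm.tracelessMap n A = 0 ↔ A.mat = (1 / Fintype.card n : ℂ) • 1 := by
  rw [Herm.tracelessMap_apply, hA, sub_eq_zero, Herm.ext_iff, Herm.mat_smul]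
  have : ((1 / Fintype.card n : ℝ) • (Herm.one : Herm n).mat) = (1 / Fintype.card n : ℂ) • 1 := by
    ext i j
    simp [Herm.one]
  rw [this]

/-- For an operator of unit trace, the affine condition on the marginal is the vanishing of its
traceless part. The set is thus cut out of all states by a linear subspace, which is the only form
in which it enters the error bound. -/
lemma gcStates_eq : gcStates d =
    {ρ | ρ.op ∈ LinearMap.ker (Herm.reducedFst (Fin d) (Fin d))} := by
  ext ρ
  rw [Set.mem_ofPred_eq, LinearMap.mem_ker, Herm.reducedFst, LinearMap.comp_apply,
    Herm.tracelessMap_eq_zero_iff (by rw [Herm.inner_ptraceFst_one, ρ.inner_op_one]),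
    Fintype.card_fin, Herm.mat_ptraceFst]
  rfl

lemma ucStates_eq : ucStates d = {ρ | ρ.op ∈ LinearMap.ker
    ((Herm.reducedFst (Fin d) (Fin d)).prod (Herm.reducedSnd (Fin d) (Fin d)))} := by
  ext ρ
  rw [Set.mem_ofPred_eq, LinearMap.ker_prod, Submodule.mem_inf, LinearMap.mem_ker, LinearMap.mem_ker,
    Herm.reducedFst, Herm.reducedSnd, LinearMap.comp_apply, LinearMap.comp_apply,
    Herm.tracelessMap_eq_zero_iff (by rw [Herm.inner_ptraceFst_one, ρ.inner_op_one]),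
    Herm.tracelessMap_eq_zero_iff (by rw [Herm.inner_ptraceSnd_one, ρ.inner_op_one]),
    Fintype.card_fin, Herm.mat_ptraceFst, Herm.mat_ptraceSnd]
  rfl

lemma Herm.one_mem_ker_reducedFst [NeZero d] :
    Herm.one ∈ LinearMap.ker (Herm.reducedFst (Fin d) (Fin d)) := by
  rw [LinearMap.mem_ker, Herm.reducedFst, LinearMap.comp_apply, Herm.ptraceFst_one, map_smul,
    Herm.tracelessMap_one, smul_zero]

lemma Herm.one_mem_ker_reducedSnd [NeZero d] :
    Herm.one ∈ LinearMap.ker (Herm.reducedSnd (Fin d) (Fin d)) := by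
  rw [LinearMap.mem_ker, Herm.reducedSnd, LinearMap.comp_apply, Herm.ptraceSnd_one, map_smul,
    Herm.tracelessMap_one, smul_zero]

/-- The unitary on the traced-out factor disappears by orthonormality of its columns
(`sum_unitary_entries`). A marginal proportional to the identity is therefore fixed by local
rotations. -/
lemma traceFst_localUnitary_conj (A : Matrix (Fin d × Fin d) (Fin d × Fin d) ℂ)
    (U V : unitaryGroup (Fin d) ℂ) :
    traceFst ((localUnitary U V).1 * A * (localUnitary U V).1ᴴ) = V.1 * traceFst A * V.1ᴴ := by
  ext i j
  have h1 : traceFst ((localUnitary U V).1 * A * (localUnitary U V).1ᴴ) i j =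
      ∑ k : Fin d × Fin d, ∑ l : Fin d × Fin d,
        A l k * (V.1 i l.2 * star (V.1 j k.2)) * if l.1 = k.1 then 1 else 0 := by
    simp only [traceFst, of_apply, localUnitary_conj_apply]
    rw [Finset.sum_comm]
    refine Finset.sum_congr rfl fun k _ => ?_
    rw [Finset.sum_comm]
    refine Finset.sum_congr rfl fun l _ => ?_
    rw [← sum_unitary_entries U k.1 l.1, Finset.mul_sum]
    refine Finset.sum_congr rfl fun a _ => ?_
    ring
  rw [h1]
  simp only [Fintype.sum_prod_type, Matrix.mul_apply, traceFst, of_apply, conjTranspose_apply,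
    mul_ite, mul_one, mul_zero]
  rw [Finset.sum_comm]
  refine Finset.sum_congr rfl fun k _ => ?_
  simp only [Finset.sum_mul, Finset.mul_sum]
  rw [Finset.sum_congr rfl fun a _ => Finset.sum_comm, Finset.sum_comm]
  refine Finset.sum_congr rfl fun l _ => Finset.sum_congr rfl fun a _ => ?_
  simp only [Finset.sum_ite_eq', Finset.mem_univ, if_true]
  ring

lemma traceSnd_localUnitary_conj (A : Matrix (Fin d × Fin d) (Fin d × Fin d) ℂ)
    (U V : unitaryGroup (Fin d) ℂ) :
    traceSnd ((localUnitary U V).1 * A * (localUnitary U V).1ᴴ) = U.1 * traceSnd A * U.1ᴴ := by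
  ext i j
  have h1 : traceSnd ((localUnitary U V).1 * A * (localUnitary U V).1ᴴ) i j =
      ∑ k : Fin d × Fin d, ∑ l : Fin d × Fin d,
        A l k * (U.1 i l.1 * star (U.1 j k.1)) * if l.2 = k.2 then 1 else 0 := by
    simp only [traceSnd, of_apply, localUnitary_conj_apply]
    rw [Finset.sum_comm]
    refine Finset.sum_congr rfl fun k _ => ?_
    rw [Finset.sum_comm]
    refine Finset.sum_congr rfl fun l _ => ?_
    rw [← sum_unitary_entries V k.2 l.2, Finset.mul_sum]
  rw [h1]
  simp only [Fintype.sum_prod_type, Matrix.mul_apply, traceSnd, of_apply, conjTranspose_apply,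
    mul_ite, mul_one, mul_zero]
  refine Finset.sum_congr rfl fun k _ => ?_
  simp only [Finset.sum_mul, Finset.mul_sum]
  rw [Finset.sum_comm]
  refine Finset.sum_congr rfl fun l _ => Finset.sum_congr rfl fun a _ => ?_
  simp only [Finset.sum_ite_eq', Finset.mem_univ, if_true]
  ring

lemma unitary_conj_smul_one (U : unitaryGroup (Fin d) ℂ) (c : ℂ) :
    U.1 * (c • 1) * U.1ᴴ = c • 1 := by
  have h : U.1 * star U.1 = 1 := (mem_unitaryGroup_iff).mp U.2
  rw [Matrix.mul_smul, Matrix.mul_one, Matrix.smul_mul, ← star_eq_conjTranspose, h]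

lemma rotate_mem_gcStates {σ : QState (Fin d × Fin d)} (hσ : σ ∈ gcStates d)
    (U V : unitaryGroup (Fin d) ℂ) : σ.rotate (localUnitary U V) ∈ gcStates d := by
  change traceFst ((localUnitary U V).1 * σ.op.mat * (localUnitary U V).1ᴴ) = _
  rw [traceFst_localUnitary_conj, hσ, unitary_conj_smul_one]

lemma rotate_mem_ucStates {σ : QState (Fin d × Fin d)} (hσ : σ ∈ ucStates d)
    (U V : unitaryGroup (Fin d) ℂ) : σ.rotate (localUnitary U V) ∈ ucStates d := by
  refine ⟨rotate_mem_gcStates hσ.1 U V, ?_⟩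
  change traceSnd ((localUnitary U V).1 * σ.op.mat * (localUnitary U V).1ᴴ) = _
  rw [traceSnd_localUnitary_conj, hσ.2, unitary_conj_smul_one]

end Channels

/-! ### Reconstruction densities are dual families -/

namespace POVM

variable {X : Type*} [MeasurableSpace X] {n : Type*} [Fintype n] [DecidableEq n] [Nonempty n]
  {F : POVM X n} {W : Submodule ℝ (Herm n)} {Q : X → Herm n}

lemma outcomeMeasure_maximallyMixed : F.outcomeMeasure (QState.maximallyMixed n) =
    ENNReal.ofReal (1 / Fintype.card n) • F.traceMeasure := by
  rw [outcomeMeasure_eq_withDensity, ← withDensity_const]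
  refine withDensity_congr_ae ?_
  filter_upwards [F.inner_density_one] with x hx
  change ENNReal.ofReal ⟪F.density x, (⟪(Herm.one : Herm n), Herm.one⟫_ℝ)⁻¹ • Herm.one⟫_ℝ = _
  rw [inner_smul_right, hx, Herm.inner_one_one, mul_one, one_div]

/-- The maximally mixed state lies in `W`, and its outcome law is `τ` divided by the dimension, so
integrability of `Q` passes to `τ`. The reconstruction formula is linear in the state and extends to
the span, which is `W`. -/
lemma IsReconstruction.isDualFamily (hW : Herm.one ∈ W)
    (hQ : F.IsReconstruction {ρ | ρ.op ∈ W} Q) :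
    IsDualFamily F.traceMeasure F.density W Q := by
  have hmem : QState.maximallyMixed n ∈ {ρ : QState n | ρ.op ∈ W} := W.smul_mem _ hW
  have hint : Integrable Q F.traceMeasure := by
    have h1 := hQ.integrable _ hmem
    rwa [outcomeMeasure_maximallyMixed, integrable_smul_measure
      (ENNReal.ofReal_pos.mpr (by simp [Fintype.card_pos])).ne' ENNReal.ofReal_ne_top] at h1
  refine ⟨fun x => QState.span_setOf_op_mem hW ▸ hQ.mem_span x, hint, fun A hA => ?_⟩
  rw [← QState.span_setOf_op_mem hW] at hA
  have hi := F.normalizedFamily_density.integrable_inner_smul hint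
  induction hA using Submodule.span_induction with
  | mem A hA =>
    obtain ⟨ρ, hρ, rfl⟩ := hA
    rw [← F.integral_outcomeMeasure]
    exact (hQ.reconstruct ρ hρ).symm
  | zero => simp
  | add A B _ _ hA hB =>
    simp only [inner_add_right, add_smul]
    rw [integral_add (hi A) (hi B), hA, hB]
  | smul r A _ hA =>
    simp only [inner_smul_right, mul_smul]
    rw [integral_smul, hA]

end POVM

/-! ### The average error -/

section AverageError

variable {d : ℕ}

instance : SecondCountableTopology (unitaryGroup (Fin d) ℂ) :=
  haveI : SecondCountableTopology (Matrix (Fin d) (Fin d) ℂ) :=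
    inferInstanceAs (SecondCountableTopology (Fin d → Fin d → ℂ))
  inferInstanceAs (SecondCountableTopology (unitaryGroup (Fin d) ℂ : Set (Matrix (Fin d) (Fin d) ℂ)))

variable (σ : QState (Fin d × Fin d))

/-- The orbit of a state under local unitaries. -/
def localOrbit (p : unitaryGroup (Fin d) ℂ × unitaryGroup (Fin d) ℂ) : QState (Fin d × Fin d) :=
  σ.rotate (localUnitary p.1 p.2)

lemma localOrbit_entry (p : unitaryGroup (Fin d) ℂ × unitaryGroup (Fin d) ℂ) (i j : Fin d × Fin d) :
    (localOrbit σ p).op.mat i j =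
      ((localUnitary p.1 p.2).1 * σ.op.mat * (localUnitary p.1 p.2).1ᴴ) i j := rfl

lemma continuous_localOrbit_entry (i j : Fin d × Fin d) :
    Continuous fun p => (localOrbit σ p).op.mat i j := by
  simp only [localOrbit_entry, localUnitary_conj_apply]
  have h1 (i j : Fin d) : Continuous
      fun p : unitaryGroup (Fin d) ℂ × unitaryGroup (Fin d) ℂ => p.1.1 i j :=
    (continuous_unitary_entry i j).comp continuous_fst
  have h2 (i j : Fin d) : Continuous
      fun p : unitaryGroup (Fin d) ℂ × unitaryGroup (Fin d) ℂ => p.2.1 i j :=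
    (continuous_unitary_entry i j).comp continuous_snd
  exact continuous_finsetSum _ fun k _ => continuous_finsetSum _ fun l _ =>
    (continuous_const.mul ((h1 _ _).mul (h1 _ _).star)).mul ((h2 _ _).mul (h2 _ _).star)

lemma inner_localOrbit (A : Herm (Fin d × Fin d))
    (p : unitaryGroup (Fin d) ℂ × unitaryGroup (Fin d) ℂ) :
    ⟪A, (localOrbit σ p).op⟫_ℝ = (∑ i, ∑ j, A.mat i j * (localOrbit σ p).op.mat j i).re := by
  rw [Herm.inner_eq_trace_mul]
  simp only [Matrix.trace, Matrix.diag, Matrix.mul_apply]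

lemma continuous_inner_localOrbit (A : Herm (Fin d × Fin d)) :
    Continuous fun p => ⟪A, (localOrbit σ p).op⟫_ℝ := by
  simp only [inner_localOrbit]
  exact Complex.continuous_re.comp (continuous_finsetSum _ fun i _ => continuous_finsetSum _ fun j _ =>
    continuous_const.mul (continuous_localOrbit_entry σ j i))

lemma integrable_of_continuous {G : Type*} [NormedAddCommGroup G]
    [SecondCountableTopology G]
    {f : unitaryGroup (Fin d) ℂ × unitaryGroup (Fin d) ℂ → G} (hf : Continuous f) :
    Integrable f ((unitaryHaar d).prod (unitaryHaar d)) :=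
  hf.integrable_of_hasCompactSupport (HasCompactSupport.of_compactSpace f)

lemma integral_inner_localOrbit (A : Herm (Fin d × Fin d)) :
    ∫ p, ⟪A, (localOrbit σ p).op⟫_ℝ ∂(unitaryHaar d).prod (unitaryHaar d) =
      ⟪A, Herm.one⟫_ℝ / (d : ℝ) ^ 2 := by
  simp only [inner_localOrbit]
  have hc (i j : Fin d × Fin d) : Integrable (fun p => A.mat i j * (localOrbit σ p).op.mat j i)
      ((unitaryHaar d).prod (unitaryHaar d)) :=
    integrable_of_continuous (continuous_const.mul (continuous_localOrbit_entry σ j i))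
  have hentry (i j : Fin d × Fin d) :
      ∫ p, (localOrbit σ p).op.mat i j ∂(unitaryHaar d).prod (unitaryHaar d) =
        if i = j then 1 / (d : ℂ) ^ 2 else 0 := by
    rw [integral_prod _ (integrable_of_continuous (continuous_localOrbit_entry σ i j))]
    simp only [localOrbit_entry]
    rw [integral_localUnitary_conj, σ.trace_eq_one]
  have hre := integral_re (𝕜 := ℂ)
    (integrable_finsetSum Finset.univ fun i _ => integrable_finsetSum Finset.univ fun j _ => hc i j)
  simp only [RCLike.re_to_complex] at hre
  rw [hre, integral_finsetSum _ fun i _ => integrable_finsetSum _ fun j _ => hc i j]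
  have h1 (i : Fin d × Fin d) :
      ∫ p, ∑ j, A.mat i j * (localOrbit σ p).op.mat j i ∂(unitaryHaar d).prod (unitaryHaar d) =
        A.mat i i / ((d ^ 2 : ℝ) : ℂ) := by
    rw [integral_finsetSum _ fun j _ => hc i j]
    simp only [integral_const_mul, hentry]
    rw [Finset.sum_eq_single i (fun j _ hj => by simp [hj]) (by simp)]
    simp [div_eq_mul_inv]
  simp only [h1]
  rw [← Finset.sum_div, Complex.div_ofReal_re, Herm.inner_one]
  rfl

variable {X : Type*} [MeasurableSpace X] (F : POVM X (Fin d × Fin d))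

/-- Expansion in an orthonormal basis separates the outcome from the unitaries, which gives the
joint measurability needed for Tonelli. -/
lemma measurable_inner_density_localOrbit : Measurable
    fun q : (unitaryGroup (Fin d) ℂ × unitaryGroup (Fin d) ℂ) × X =>
      ⟪F.density q.2, (localOrbit σ q.1).op⟫_ℝ := by
  have h1 (q : (unitaryGroup (Fin d) ℂ × unitaryGroup (Fin d) ℂ) × X) :
      ⟪F.density q.2, (localOrbit σ q.1).op⟫_ℝ =
        ∑ k, ⟪F.density q.2, stdOrthonormalBasis ℝ (Herm (Fin d × Fin d)) k⟫_ℝ *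
          ⟪stdOrthonormalBasis ℝ (Herm (Fin d × Fin d)) k, (localOrbit σ q.1).op⟫_ℝ :=
    ((stdOrthonormalBasis ℝ (Herm (Fin d × Fin d))).sum_inner_mul_inner _ _).symm
  simp only [h1]
  exact Finset.measurable_fun_sum _ fun k _ =>
    ((F.measurable_inner_density _).comp measurable_snd).mul
      ((continuous_inner_localOrbit σ _).measurable.comp measurable_fst)

lemma lintegral_inner_density_localOrbit : ∀ᵐ x ∂F.traceMeasure,
    ∫⁻ p, ENNReal.ofReal ⟪F.density x, (localOrbit σ p).op⟫_ℝ
      ∂(unitaryHaar d).prod (unitaryHaar d) = ENNReal.ofReal (1 / (d : ℝ) ^ 2) := by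
  filter_upwards [F.posSemidef_density, F.inner_density_one] with x h1 h2
  rw [← ofReal_integral_eq_lintegral_ofReal
    (integrable_of_continuous (continuous_inner_localOrbit σ _)), integral_inner_localOrbit, h2]
  refine Filter.Eventually.of_forall fun p => ?_
  change 0 ≤ ⟪_, _⟫_ℝ
  rw [Herm.inner_eq_trace_mul]
  exact h1.re_trace_mul_nonneg (localOrbit σ p).posSemidef

/-- After exchanging the integrals, the inner one averages the outcome density at a fixed `x` over
the orbit. Twirling sends the state to the maximally mixed one and `P` has unit trace, so this
average is `1 / d ^ 2`. -/
lemma lintegral_lintegral_localOrbit {f : X → ℝ≥0∞} (hf : AEMeasurable f F.traceMeasure) :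
    ∫⁻ U, ∫⁻ V, ∫⁻ x, f x ∂F.outcomeMeasure (localOrbit σ (U, V)) ∂unitaryHaar d ∂unitaryHaar d =
      ENNReal.ofReal (1 / (d : ℝ) ^ 2) * ∫⁻ x, f x ∂F.traceMeasure := by
  simp only [F.lintegral_outcomeMeasure _ hf]
  have hm : AEMeasurable (fun q : (unitaryGroup (Fin d) ℂ × unitaryGroup (Fin d) ℂ) × X =>
      ENNReal.ofReal ⟪F.density q.2, (localOrbit σ q.1).op⟫_ℝ * f q.2)
      (((unitaryHaar d).prod (unitaryHaar d)).prod F.traceMeasure) :=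
    (measurable_inner_density_localOrbit σ F).ennreal_ofReal.aemeasurable.mul
      (hf.comp_quasiMeasurePreserving Measure.quasiMeasurePreserving_snd)
  rw [← lintegral_prod (fun p => ∫⁻ x, ENNReal.ofReal ⟪F.density x, (localOrbit σ p).op⟫_ℝ * f x
    ∂F.traceMeasure) hm.lintegral_prod_right', lintegral_lintegral_swap hm,
    ← lintegral_const_mul'' _ hf]
  refine lintegral_congr_ae ?_
  filter_upwards [lintegral_inner_density_localOrbit σ F] with x hx
  rw [lintegral_mul_const, hx]
  exact (continuous_inner_localOrbit σ _).measurable.ennreal_ofReal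

variable {S : Set (QState (Fin d × Fin d))} {F} {Q : X → Herm (Fin d × Fin d)}

/-- The average of `expectedError_add` over the orbit, on which the purity is constant. The purity
stands on the left as a summand because the errors are extended nonnegative numbers, where
subtraction would truncate. -/
lemma averageError_add (hQ : F.IsReconstruction S Q) (hQm : AEStronglyMeasurable Q F.traceMeasure)
    {N : ℕ} (hN : 0 < N) (hσ : ∀ U V, σ.rotate (localUnitary U V) ∈ S) :
    averageError F Q N σ + ENNReal.ofReal (σ.purity / N) =
      ENNReal.ofReal (1 / N) * (ENNReal.ofReal (1 / (d : ℝ) ^ 2) *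
        ∫⁻ x, ENNReal.ofReal (‖Q x‖ ^ 2) ∂F.traceMeasure) := by
  have he (U V : unitaryGroup (Fin d) ℂ) := expectedError_add hQ hN (hσ U V)
  simp only [← QState.purity_eq, QState.purity_rotate] at he
  have hm : AEMeasurable (fun x => ENNReal.ofReal (‖Q x‖ ^ 2)) F.traceMeasure :=
    (hQm.norm.aemeasurable.pow_const 2).ennreal_ofReal
  rw [← lintegral_lintegral_localOrbit σ F hm]
  have h1 (U : unitaryGroup (Fin d) ℂ) :
      ∫⁻ V, expectedError F Q N (σ.rotate (localUnitary U V)) ∂unitaryHaar d +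
        ENNReal.ofReal (σ.purity / N) = ENNReal.ofReal (1 / N) * ∫⁻ V, ∫⁻ x,
          ENNReal.ofReal (‖Q x‖ ^ 2) ∂F.outcomeMeasure (localOrbit σ (U, V)) ∂unitaryHaar d := by
    rw [← lintegral_const_mul' _ _ ENNReal.ofReal_ne_top]
    refine Eq.trans ?_ (lintegral_congr (he U))
    rw [lintegral_add_right _ measurable_const, lintegral_const, measure_univ, mul_one]
  rw [← lintegral_const_mul' _ _ ENNReal.ofReal_ne_top]
  refine Eq.trans ?_ (lintegral_congr h1)
  rw [lintegral_add_right _ measurable_const, lintegral_const, measure_univ, mul_one]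
  rfl

lemma averageError_le_worstCaseError (F : POVM X (Fin d × Fin d)) (Q : X → Herm (Fin d × Fin d))
    (N : ℕ) : averageError F Q N σ ≤ worstCaseError F Q N σ := by
  calc averageError F Q N σ ≤ ∫⁻ _, ∫⁻ _, worstCaseError F Q N σ ∂unitaryHaar d ∂unitaryHaar d :=
        lintegral_mono fun U => lintegral_mono fun V => le_iSup₂_of_le U V le_rfl
    _ = worstCaseError F Q N σ := by simp

end AverageError

/-! ### The error bound -/

section ErrorBound

variable {X : Type*} [MeasurableSpace X]

namespace POVM

variable {n : Type*} [Fintype n] [DecidableEq n] [Nonempty n] {F : POVM X n}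
  {W : Submodule ℝ (Herm n)} {Q : X → Herm n}

/-- An optimal dual is the canonical dual of a tight rank-one measurement. -/
lemma optimal_of_lintegral_norm_sq_eq (hW : Herm.one ∈ W)
    (hQ : IsDualFamily F.traceMeasure F.density W Q) {α : ℝ} (hα1 : 1 ≤ α)
    (hα : (Module.finrank ℝ W : ℝ) - 1 = α * (Fintype.card n - 1))
    (heq : ∫⁻ x, ENNReal.ofReal (‖Q x‖ ^ 2) ∂F.traceMeasure =
      ENNReal.ofReal (1 + α ^ 2 * (Fintype.card n - 1))) :
    Q =ᵐ[F.traceMeasure] F.canonicalDual ∧ F.IsTight ∧ F.IsRankOne ∧ opSupport F.frameOp = W := by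
  have hP := F.normalizedFamily_density
  have hα0 : 0 < α := zero_lt_one.trans_le hα1
  have hcard : (1 : ℝ) ≤ Fintype.card n := by exact_mod_cast Fintype.card_pos
  rw [← Herm.inner_one_one (n := n)] at hα heq hcard
  have hae := hP.ae_of_lintegral_norm_sq_dual_eq hQ hW hα0 hcard hα heq
  have hG (A : Herm n) (hA : A ∈ W) := hP.frameOperator_eq_of_dual_eq hQ hα0
    (hae.mono fun x hx => hx.2.2) hA
  obtain ⟨hsupp, htight⟩ := hP.isTight_of_frameOperator_eq hW (hae.mono fun x hx => hx.1)
    F.tracelessPart_density (inv_pos.mpr hα0) hG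
  refine ⟨?_, ⟨α⁻¹, inv_pos.mpr hα0, htight⟩,
    F.isRankOne_iff.mpr (hae.mono fun x hx => hx.2.1), hsupp⟩
  filter_upwards [hae, F.inner_density_one] with x hx hx1
  have h1 := hP.supportInverse_apply_of_frameOperator_eq hW (inv_pos.mpr hα0)
    (existsUnique_supportInverse F.frameOp_symm).choose_spec.1 hsupp hG hx.1 hx1
  rw [inv_inv, ← hx.2.2] at h1
  exact h1.symm

/-- The canonical dual of a tight rank-one measurement has constant norm. -/
lemma norm_sq_eq_of_optimal (hW : Herm.one ∈ W)
    (hQ : IsDualFamily F.traceMeasure F.density W Q) {α : ℝ}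
    (hα : (Module.finrank ℝ W : ℝ) - 1 = α * (Fintype.card n - 1))
    (hcan : Q =ᵐ[F.traceMeasure] F.canonicalDual) (htight : F.IsTight) (hrank : F.IsRankOne)
    (hsupp : opSupport F.frameOp = W) :
    ∀ᵐ x ∂F.traceMeasure, ‖Q x‖ ^ 2 = (1 + α ^ 2 * (Fintype.card n - 1)) / Fintype.card n := by
  have hP := F.normalizedFamily_density
  obtain ⟨a, ha, ht⟩ := htight
  rw [← Herm.inner_one_one (n := n)] at hα ⊢
  have hG (A : Herm n) (hA : A ∈ W) := hP.frameOperator_eq_of_isTight F.tracelessPart_density ht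
    (A := A) (hsupp ▸ hA)
  have hmem : ∀ᵐ x ∂F.traceMeasure, F.density x ∈ W :=
    hP.ae_mem_opSupport.mono fun x hx => hsupp ▸ hx
  have hnorm := F.isRankOne_iff.mp hrank
  have hQeq : ∀ᵐ x ∂F.traceMeasure, Q x = (1 / ⟪(Herm.one : Herm n), Herm.one⟫_ℝ) • Herm.one +
      a⁻¹ • (F.density x - (1 / ⟪(Herm.one : Herm n), Herm.one⟫_ℝ) • Herm.one) := by
    filter_upwards [hcan, hmem, F.inner_density_one] with x hx hx1 hx2
    rw [hx]
    exact hP.supportInverse_apply_of_frameOperator_eq hW ha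
      (existsUnique_supportInverse F.frameOp_symm).choose_spec.1 hsupp hG hx1 hx2
  have hslope := hP.slope_mul_eq_of_dual_eq hQ hnorm hQeq
  filter_upwards [hQeq, hnorm, F.inner_density_one] with x hx hx1 hx2
  rw [hx, hP.norm_sq_affine hx1 hx2]
  congr 2
  rw [hα] at hslope
  linear_combination (-a⁻¹ - α) * hslope

end POVM

variable {d N : ℕ}

/-- The three sets of states differ only through the dimension of `W`, encoded in the slope `α`; the
bound `b` is the minimal second moment divided by the mass of `τ`. -/
theorem error_bound_of_submodule [NeZero d] (hN : 0 < N) {F : POVM X (Fin d × Fin d)}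
    {W : Submodule ℝ (Herm (Fin d × Fin d))} (hW : Herm.one ∈ W) {α : ℝ} (hα1 : 1 ≤ α)
    (hα : (Module.finrank ℝ W : ℝ) - 1 = α * ((d : ℝ) ^ 2 - 1)) {b : ℝ}
    (hb : b = (1 + α ^ 2 * ((d : ℝ) ^ 2 - 1)) / (d : ℝ) ^ 2) {σ : QState (Fin d × Fin d)}
    (hσ : ∀ U V, (σ.rotate (localUnitary U V)).op ∈ W) {Q : X → Herm (Fin d × Fin d)}
    (hQ : F.IsReconstruction {ρ | ρ.op ∈ W} Q) :
    averageError F Q N σ ≤ worstCaseError F Q N σ ∧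
    ENNReal.ofReal ((b - σ.purity) / N) ≤ averageError F Q N σ ∧
    (averageError F Q N σ = ENNReal.ofReal ((b - σ.purity) / N) ↔
      Q =ᵐ[F.traceMeasure] F.canonicalDual ∧ F.IsTight ∧ F.IsRankOne ∧
        opSupport F.frameOp = QState.span {ρ | ρ.op ∈ W}) ∧
    (averageError F Q N σ = ENNReal.ofReal ((b - σ.purity) / N) →
      worstCaseError F Q N σ = averageError F Q N σ) := by
  have hP := F.normalizedFamily_density
  have hdual := hQ.isDualFamily hW
  have hN' : (0 : ℝ) < N := by exact_mod_cast hN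
  have hd1 : (1 : ℝ) ≤ (d : ℝ) ^ 2 := by
    exact_mod_cast Nat.one_le_pow 2 d (Nat.pos_of_ne_zero (NeZero.ne d))
  have hd0 : (0 : ℝ) < (d : ℝ) ^ 2 := zero_lt_one.trans_le hd1
  have hcard : ((Fintype.card (Fin d × Fin d) : ℕ) : ℝ) = (d : ℝ) ^ 2 := by simp [sq]
  have hinner : ⟪(Herm.one : Herm (Fin d × Fin d)), Herm.one⟫_ℝ = (d : ℝ) ^ 2 := by
    rw [Herm.inner_one_one, hcard]
  set K : ℝ := 1 + α ^ 2 * ((d : ℝ) ^ 2 - 1) with hK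
  have hKd : (d : ℝ) ^ 2 ≤ K := by
    have := mul_nonneg (sub_nonneg.mpr (one_le_pow₀ hα1 (n := 2))) (sub_nonneg.mpr hd1)
    linarith
  -- Together with purity at most one, this ensures that `ENNReal.ofReal ((b - σ.purity) / N)` does
  -- not truncate a negative number. It is where `1 ≤ α` is needed beyond `0 < α`.
  have hb1 : 1 ≤ b := by rw [hb, le_div_iff₀ hd0, one_mul]; exact hKd
  set c := ENNReal.ofReal (σ.purity / N) with hc
  have hc_top : c ≠ ∞ := ENNReal.ofReal_ne_top
  have hp0 : 0 ≤ σ.purity := by rw [QState.purity_eq]; positivity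
  have hbound : ENNReal.ofReal ((b - σ.purity) / N) + c = ENNReal.ofReal (1 / N) *
      (ENNReal.ofReal (1 / (d : ℝ) ^ 2) * ENNReal.ofReal K) := by
    rw [hc, ← ENNReal.ofReal_add
      (div_nonneg (sub_nonneg.mpr (σ.purity_le_one.trans hb1)) hN'.le) (by positivity),
      ← ENNReal.ofReal_mul (by positivity), ← ENNReal.ofReal_mul (by positivity), hb]
    congr 1
    field_simp
    ring
  have havg := averageError_add σ hQ hdual.integrable.aestronglyMeasurable hN hσ
  have hle : ENNReal.ofReal K ≤ ∫⁻ x, ENNReal.ofReal (‖Q x‖ ^ 2) ∂F.traceMeasure := by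
    have := hP.le_lintegral_norm_sq_dual hdual hW (hinner.symm ▸ hα)
    rwa [hinner] at this
  have hN0 : ENNReal.ofReal (1 / N) ≠ 0 := (ENNReal.ofReal_pos.mpr (by positivity)).ne'
  have hD0 : ENNReal.ofReal (1 / (d : ℝ) ^ 2) ≠ 0 := (ENNReal.ofReal_pos.mpr (by positivity)).ne'
  have hiff : averageError F Q N σ = ENNReal.ofReal ((b - σ.purity) / N) ↔
      ∫⁻ x, ENNReal.ofReal (‖Q x‖ ^ 2) ∂F.traceMeasure = ENNReal.ofReal K := by
    rw [← ENNReal.add_left_inj hc_top, hbound, havg,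
      ENNReal.mul_right_inj hN0 ENNReal.ofReal_ne_top,
      ENNReal.mul_right_inj hD0 ENNReal.ofReal_ne_top]
  have hspan := QState.span_setOf_op_mem hW
  have hforward (h : averageError F Q N σ = ENNReal.ofReal ((b - σ.purity) / N)) :=
    F.optimal_of_lintegral_norm_sq_eq hW hdual hα1 (hcard.symm ▸ hα) (hcard.symm ▸ hiff.mp h)
  have hconst (h : Q =ᵐ[F.traceMeasure] F.canonicalDual ∧ F.IsTight ∧ F.IsRankOne ∧
      opSupport F.frameOp = W) :
      ∀ᵐ x ∂F.traceMeasure, ‖Q x‖ ^ 2 = K / (d : ℝ) ^ 2 := by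
    have := F.norm_sq_eq_of_optimal hW hdual (hcard.symm ▸ hα) h.1 h.2.1 h.2.2.1 h.2.2.2
    rwa [hcard] at this
  refine ⟨averageError_le_worstCaseError σ F Q N, ?_, ?_, ?_⟩
  · rw [← ENNReal.add_le_add_iff_right hc_top, hbound, havg]
    gcongr
  · rw [hspan]
    refine ⟨hforward, fun h => hiff.mpr ?_⟩
    have hmass : F.traceMeasure Set.univ = ENNReal.ofReal ((d : ℝ) ^ 2) := by
      rw [← hinner, ← hP.measureReal_univ, ofReal_measureReal]
    rw [lintegral_congr_ae ((hconst h).mono fun x hx => by rw [hx]), lintegral_const, hmass,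
      ← ENNReal.ofReal_mul (by positivity), div_mul_cancel₀ _ hd0.ne']
  · intro h
    have hnorm := hconst (hforward h)
    -- At the optimum `‖Q‖²` is constant almost everywhere, so its mean is the same under every
    -- outcome law, and the error does not vary along the orbit.
    have he (U V : unitaryGroup (Fin d) ℂ) : expectedError F Q N (σ.rotate (localUnitary U V)) =
        averageError F Q N σ := by
      have h1 := expectedError_add hQ hN (hσ U V)
      have h2 : ∀ᵐ x ∂F.outcomeMeasure (σ.rotate (localUnitary U V)),
          ENNReal.ofReal (‖Q x‖ ^ 2) = ENNReal.ofReal (K / (d : ℝ) ^ 2) := by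
        filter_upwards [(F.outcomeMeasure_absolutelyContinuous _).ae_le hnorm] with x hx
        rw [hx]
      rw [lintegral_congr_ae h2, lintegral_const, measure_univ, mul_one, ← QState.purity_eq,
        QState.purity_rotate] at h1
      rw [← ENNReal.add_left_inj hc_top, h1, havg, hiff.mp h,
        ← ENNReal.ofReal_mul (by positivity) (p := 1 / (d : ℝ) ^ 2), one_div_mul_eq_div]
    simp only [worstCaseError, he, iSup_const]

end ErrorBound

/-! ### The three sets of states -/

theorem mainTheorem2 {X : Type*} [MeasurableSpace X] (d N : ℕ) (hN : 0 < N)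
    (F : POVM X (Fin d × Fin d)) (S : Set (QState (Fin d × Fin d))) (b : ℝ)
    (hS : (S = Set.univ ∧ b = (d : ℝ) ^ 4 + (d : ℝ) ^ 2 - 1) ∨
      (S = gcStates d ∧ b = (d : ℝ) ^ 4 - (d : ℝ) ^ 2 + 1 / (d : ℝ) ^ 2) ∨
      (S = ucStates d ∧ b = (d : ℝ) ^ 4 - 3 * (d : ℝ) ^ 2 + 3))
    (hF : F.IsInfoComplete S) (σ : QState (Fin d × Fin d)) (hσ : σ ∈ S)
    (Q : X → Herm (Fin d × Fin d)) (hQ : F.IsReconstruction S Q) :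
    averageError F Q N σ ≤ worstCaseError F Q N σ ∧
    ENNReal.ofReal ((b - σ.purity) / N) ≤ averageError F Q N σ ∧
    (averageError F Q N σ = ENNReal.ofReal ((b - σ.purity) / N) ↔
      Q =ᵐ[F.traceMeasure] F.canonicalDual ∧ F.IsTight ∧ F.IsRankOne ∧
        opSupport F.frameOp = QState.span S) ∧
    (averageError F Q N σ = ENNReal.ofReal ((b - σ.purity) / N) →
      worstCaseError F Q N σ = averageError F Q N σ) := by
  -- In dimension zero every trace is zero, so there is no state `σ`.
  have hd : d ≠ 0 := by
    rintro rfl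
    have h := σ.trace_eq_one
    simp [Matrix.trace] at h
  have : NeZero d := ⟨hd⟩
  have hd' : (d : ℝ) ≠ 0 := by exact_mod_cast hd
  -- The spans have dimensions `d⁴`, `d⁴ - d² + 1` and `d⁴ - 2d² + 2`. Division of the dimension
  -- minus one by `d² - 1` gives the slopes `d² + 1`, `d²` and `d² - 1`.
  rcases hS with ⟨rfl, hb⟩ | ⟨rfl, hb⟩ | ⟨rfl, hb⟩
  · have hS : (Set.univ : Set (QState (Fin d × Fin d))) =
        {ρ | ρ.op ∈ (⊤ : Submodule ℝ (Herm (Fin d × Fin d)))} := by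
      ext; simp
    rw [hS] at hQ ⊢
    refine error_bound_of_submodule hN Submodule.mem_top (α := (d : ℝ) ^ 2 + 1) (by nlinarith)
      ?_ ?_ (fun _ _ => Submodule.mem_top) hQ
    · rw [finrank_top, Herm.finrank_eq]
      simp
      ring
    · rw [hb]
      field_simp
      ring
  · have hrot (U V) := rotate_mem_gcStates hσ U V
    rw [gcStates_eq] at hQ hrot ⊢
    have hdim : (Module.finrank ℝ (LinearMap.ker (Herm.reducedFst (Fin d) (Fin d))) : ℝ) +
        (d : ℝ) ^ 2 = ((d : ℝ) * d) ^ 2 + 1 := by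
      have := Herm.finrank_ker_reducedFst (m := Fin d) (n := Fin d)
      simp only [Fintype.card_fin] at this
      exact_mod_cast this
    refine error_bound_of_submodule hN Herm.one_mem_ker_reducedFst (α := (d : ℝ) ^ 2) ?_
      (by linear_combination hdim) ?_ hrot hQ
    · exact_mod_cast Nat.one_le_pow 2 d (Nat.pos_of_ne_zero hd)
    · rw [hb]
      field_simp
      ring
  · have hrot (U V) := rotate_mem_ucStates hσ U V
    rw [ucStates_eq] at hQ hrot ⊢
    have hdim : (Module.finrank ℝ (LinearMap.ker
        ((Herm.reducedFst (Fin d) (Fin d)).prod (Herm.reducedSnd (Fin d) (Fin d)))) : ℝ) +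
        (d : ℝ) ^ 2 + (d : ℝ) ^ 2 = ((d : ℝ) * d) ^ 2 + 2 := by
      have := Herm.finrank_ker_reducedFst_prod_reducedSnd (m := Fin d) (n := Fin d)
      simp only [Fintype.card_fin] at this
      exact_mod_cast this
    have hone : Herm.one ∈ LinearMap.ker
        ((Herm.reducedFst (Fin d) (Fin d)).prod (Herm.reducedSnd (Fin d) (Fin d))) := by
      rw [LinearMap.ker_prod]
      exact ⟨Herm.one_mem_ker_reducedFst, Herm.one_mem_ker_reducedSnd⟩
    -- For `d = 1` the generic slope `d ^ 2 - 1` is zero and violates `1 ≤ α`. The dimension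
    -- equation then reads `0 = α * 0`, so `α = 1` may be taken instead, and `b = 1`.
    rcases Nat.lt_or_ge d 2 with h2 | h2
    · obtain rfl : d = 1 := by omega
      refine error_bound_of_submodule hN hone (α := 1) le_rfl (by linear_combination hdim) ?_ hrot hQ
      rw [hb]
      norm_num
    · have h2' : (2 : ℝ) ≤ d := by exact_mod_cast h2
      refine error_bound_of_submodule hN hone (α := (d : ℝ) ^ 2 - 1) (by nlinarith)
        (by linear_combination hdim) ?_ hrot hQ
      rw [hb]
      field_simp
      ring

end
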